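/- Conventions. Manifolds are smooth and Hausdorff, without boundary; tensors and connections are smooth. The curvature of a torsion-free affine connection $\nabla$ is $R(X,Y)Z=\nabla_X\nabla_YZ-\nabla_Y\nabla_XZ-\nabla_{[X,Y]}Z=R_{ijk}{}^{l}X^iY^jZ^k$ and its Ricci curvature is $R_{ij}=R_{pij}{}^{p}$. Square brackets (parentheses) around indices denote skew-symmetrization (symmetrization). A para-Kähler manifold $(N,g,J)$ is a manifold with a pseudo-Riemannian metric $g$ and an endomorphism $J$ of $TN$ such that $J^2=\mathrm{Id}$, $\Omega(X,Y)=g(JX,Y)$ is skew-symmetric, and $J$ is parallel for the Levi-Civita connection of $g$ (so that $\Omega$ is symplectic and $g$ has split signature). It has constant para-holomorphic sectional curvature $4c$, $c\in\mathbb R$, if the curvature of its Levi-Civita connection is $$R_{ijk}{}^{l}=2c\left(\delta_{[i}{}^{l}g_{j]k}-J_{[i}{}^{l}\Omega_{j]k}+\Omega_{ij}J_k{}^{l}\right).$$ An AH structure on a surface $M$ is a pair $([\nabla],[h])$ of a projective equivalence class $[\nabla]$ of torsion-free affine connections (two such being equivalent when they differ by $\sigma_i\delta_j{}^k+\sigma_j\delta_i{}^k$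 for some one-form $\sigma$) and a conformal structure $[h]$, such that for each $\nabla\in[\nabla]$ and $h\in[h]$ there is a one-form $\sigma$ with $\nabla_{[i}h_{j]k}=2\sigma_{[i}h_{j]k}$. Its aligned representative is the unique $\nabla\in[\nabla]$ with $2h^{pq}\nabla_ph_{qi}=h^{pq}\nabla_ih_{pq}$ for all $h\in[h]$; from now on $\nabla$ and $R_{ijk}{}^l$ refer to it. The structure is Riemannian if the metrics $h\in[h]$ are positive definite. It is exact if some $h\in[h]$, then called a distinguished representative, satisfies $\nabla\det h=0$. Its weighted scalar curvature is the density $R=|\det h|^{1/2}h^{ij}R_{ij}$ and its Faraday form is $F_{ij}=\frac12R_{ijp}{}^{p}$. The structure is Einstein if $R_{(ij)}=\frac12(h^{pq}R_{pq})h_{ij}$ and $\nabla_iR+2\nabla^pF_{ip}=0$, where the index is raised with $|\det h|^{1/2}h^{pq}$; neither condition depends on $h\in[h]$. Theorem. Let $(N,g,J)$ be a four-dimensional para-Kähler manifold of constant para-holomorphic sectional curvature $4c$, and let $f:M\to N$ be an immersion of a surface which is spacelike ($h=f^*g$ is positive definite), Lagrangian ($f^*\Omega=0$), and of mean curvature zero.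 Let $D$ be the Levi-Civita connection of $h$, let $\Pi$ be the second fundamental form of $f$, let $\Pi_{ijk}$ be the tensor $\Pi(X,Y,Z)=\Omega(\Pi(X,Y),df(Z))$ on $M$, let $H_i=\Pi_{ipq}h^{pq}$, and let $B_{ijk}=\Pi_{ijk}-\frac34H_{(i}h_{jk)}$ be the completely trace-free part of $\Pi_{ijk}$ (here $H_i=0$). Then $\nabla=D-B_{ijp}h^{pk}$ is a torsion-free connection, and the projective class $[\nabla]$ of $\nabla$ and the conformal class $[h]$ of $h$ form a Riemannian AH structure $([\nabla],[h])$ on $M$ with aligned representative $\nabla$. This AH structure is exact, with distinguished representative $h$, it is Einstein, and its scalar curvature with respect to $h$ is the constant $h^{ij}R_{ij}=2c$. -/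

import Mathlib

open Bundle
open scoped Manifold ContDiff Topology

noncomputable section

namespace ParaKahlerAH

/-! ### Tensors, metrics and affine connections on a smooth manifold

All manifolds are modelled on `EuclideanSpace ℝ (Fin n)` (hence without boundary). -/

section Basic

variable {n : ℕ} {M : Type*} [TopologicalSpace M] [ChartedSpace (EuclideanSpace ℝ (Fin n)) M]

/-- A basis `e_1, …, e_n` of the tangent space at `x` (that of the preferred chart at `x`); it
serves to write contractions with indices. No contraction below depends on it. -/
abbrev frame (x : M) : Module.Basis (Fin n) ℝ (TangentSpace (𝓡 n) x) :=
  (EuclideanSpace.basisFun (Fin n) ℝ).toBasis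

variable (n M) in
/-- A (pseudo-Riemannian) metric: a smooth, symmetric, non-degenerate covariant two-tensor. -/
structure Metric [IsManifold (𝓡 n) ∞ M] where
  /-- The bilinear form on each tangent space. -/
  val : Π x : M, TangentSpace (𝓡 n) x →L[ℝ] TangentSpace (𝓡 n) x →L[ℝ] ℝ
  symm : ∀ x u v, val x u v = val x v u
  nondegenerate : ∀ x u, (∀ v, val x u v = 0) → u = 0
  smooth : ContMDiff (𝓡 n)
    ((𝓡 n).prod 𝓘(ℝ, EuclideanSpace ℝ (Fin n) →L[ℝ] EuclideanSpace ℝ (Fin n) →L[ℝ] ℝ)) ∞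
    (fun x ↦ TotalSpace.mk' (EuclideanSpace ℝ (Fin n) →L[ℝ] EuclideanSpace ℝ (Fin n) →L[ℝ] ℝ)
      x (val x))

variable (n M) in
/-- A bilinear form on each tangent space, as a plain function. -/
abbrev Form₂ := Π x : M, TangentSpace (𝓡 n) x → TangentSpace (𝓡 n) x → ℝ

/-- The bilinear forms underlying a metric. -/
def Metric.form [IsManifold (𝓡 n) ∞ M] (h : Metric n M) : Form₂ n M := fun x u v ↦ h.val x u v

variable (n M) in
/-- Affine connections, i.e. covariant derivatives on the tangent bundle. In Mathlib's order of
arguments, `D Y x u` is `∇_u Y` at the point `x`. -/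
abbrev Connection [IsManifold (𝓡 n) ∞ M] :=
  CovariantDerivative (𝓡 n) (EuclideanSpace ℝ (Fin n)) (TangentSpace (𝓡 n) : M → Type _)

variable [IsManifold (𝓡 n) ∞ M]

/-- A tangent vector at `x`, extended to a vector field which is smooth near `x` (constant in a
local trivialization). -/
abbrev ext {x : M} (v : TangentSpace (𝓡 n) x) : Π y : M, TangentSpace (𝓡 n) y :=
  FiberBundle.extend (EuclideanSpace ℝ (Fin n)) v

/-- The vector field `Y` is differentiable at `x`. -/
abbrev DiffAt (Y : Π y : M, TangentSpace (𝓡 n) y) (x : M) : Prop :=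
  MDifferentiableAt (𝓡 n) ((𝓡 n).prod 𝓘(ℝ, EuclideanSpace ℝ (Fin n)))
    (fun y ↦ TotalSpace.mk' (EuclideanSpace ℝ (Fin n)) y (Y y)) x

/-- Smooth torsion-free connections. -/
def IsTorsionFree (D : Connection n M) : Prop :=
  D.ContMDiffCovariantDerivative ∞ ∧ D.torsion = 0

/-- The covariant derivative of a covariant two-tensor:
`(∇_u T)(v, w) = u (T(V, W)) - T(∇_u V, w) - T(v, ∇_u W)`, where `V`, `W` extend `v`, `w`. -/
def covDeriv₂ (D : Connection n M) (T : Form₂ n M) (x : M) (u v w : TangentSpace (𝓡 n) x) : ℝ :=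
  mvfderiv (𝓡 n) (fun y : M ↦ T y (ext v y) (ext w y)) x u
    - T x (D (ext v) x u) w - T x v (D (ext w) x u)

/-- `D` is the Levi-Civita connection of the metric `h`. -/
def IsLeviCivita (h : Metric n M) (D : Connection n M) : Prop :=
  IsTorsionFree D ∧ ∀ x u v w, covDeriv₂ D h.form x u v w = 0

/-- The curvature `R(u, v) w = ∇_U ∇_V W - ∇_V ∇_U W - ∇_{[U, V]} W`, where `U`, `V`, `W` extend
`u`, `v`, `w`. In index notation `R(u, v) w = R_{ijk}^l u^i v^j w^k`. -/
def curvature (D : Connection n M) (x : M) (u v w : TangentSpace (𝓡 n) x) :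
    TangentSpace (𝓡 n) x :=
  D (fun y ↦ D (ext w) y (ext v y)) x u - D (fun y ↦ D (ext w) y (ext u y)) x v
    - D (ext w) x (VectorField.mlieBracket (𝓡 n) (ext u) (ext v) x)

/-- The Ricci curvature `R_{ij} = R_{pij}^p` of a connection. -/
def ricci (D : Connection n M) (x : M) (v w : TangentSpace (𝓡 n) x) : ℝ :=
  ∑ p, (frame x).repr (curvature D x (frame x p) v w) p

/-- The inverse `h^{ij}` of a non-degenerate symmetric form, in the basis `frame x`. -/
def inverse (h : Form₂ n M) (x : M) : Matrix (Fin n) (Fin n) ℝ :=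
  (Matrix.of fun i j ↦ h x (frame x i) (frame x j))⁻¹

/-- The trace `h^{pq} T_{pq}` of a bilinear map on the tangent space at `x`. -/
def metricTrace {V : Type*} [AddCommGroup V] [Module ℝ V] (h : Form₂ n M) (x : M)
    (T : TangentSpace (𝓡 n) x → TangentSpace (𝓡 n) x → V) : V :=
  ∑ p, ∑ q, inverse h x p q • T (frame x p) (frame x q)

/-- The scalar trace `h^{ij} R_{ij}` of the Ricci curvature of the connection `D`. -/
def scalar (D : Connection n M) (h : Metric n M) (x : M) : ℝ :=
  metricTrace h.form x (ricci D x)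

/-- The covariant derivative of a density. Densities of weight `l` are written `φ |det h|^{l/2}`;
then `∇_u (φ |det h|^{l/2}) = θ(u) |det h|^{l/2}`, where
`θ(u) = dφ(u) + (l/2) φ h^{pq} (∇_u h)_{pq}` is the number given here. -/
def densityDeriv (D : Connection n M) (h : Metric n M) (l : ℝ) (φ : M → ℝ) (x : M)
    (u : TangentSpace (𝓡 n) x) : ℝ :=
  mvfderiv (𝓡 n) φ x u
    + l / 2 * φ x * metricTrace h.form x (covDeriv₂ D h.form x u)

end Basic

/-! ### AH structures on surfaces -/

section AH

variable {M : Type*} [TopologicalSpace M] [ChartedSpace (EuclideanSpace ℝ (Fin 2)) M]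
  [IsManifold (𝓡 2) ∞ M]

/-- The projective structure generated by a torsion-free connection `D`: all smooth torsion-free
connections whose difference tensor with `D` is pure trace, i.e. of the form
`σ_i δ_j^k + σ_j δ_i^k`. -/
def projectiveClass (D : Connection 2 M) : Set (Connection 2 M) :=
  {D' | IsTorsionFree D' ∧ ∃ σ : Π x : M, TangentSpace (𝓡 2) x →L[ℝ] ℝ,
    ∀ (x : M) (Y : Π y : M, TangentSpace (𝓡 2) y), DiffAt Y x → ∀ u : TangentSpace (𝓡 2) x,
      D' Y x u = D Y x u + σ x u • Y x + σ x (Y x) • u}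

/-- The conformal structure generated by a metric `h`: all metrics `φ h` with `φ` a smooth positive
function. -/
def conformalClass (h : Metric 2 M) : Set (Metric 2 M) :=
  {h' | ∃ φ : M → ℝ, ContMDiff (𝓡 2) 𝓘(ℝ) ∞ φ ∧ (∀ x, 0 < φ x) ∧
    ∀ x u v, h'.val x u v = φ x * h.val x u v}

variable (M) in
/-- An AH structure on a surface: a projective equivalence class of torsion-free connections and a
conformal structure, such that for every connection `∇` and every metric `h` in these classes there
is a one-form `σ` with `∇_{[i} h_{j]k} = 2 σ_{[i} h_{j]k}`. -/
structure AHStructure where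
  /-- The projective structure. -/
  proj : Set (Connection 2 M)
  /-- The conformal structure. -/
  conf : Set (Metric 2 M)
  isProjective : ∃ D, IsTorsionFree D ∧ proj = projectiveClass D
  isConformal : ∃ h, conf = conformalClass h
  compatible : ∀ D ∈ proj, ∀ h ∈ conf, ∃ σ : Π x : M, TangentSpace (𝓡 2) x →L[ℝ] ℝ,
    ∀ x u v w, covDeriv₂ D h.form x u v w
        - covDeriv₂ D h.form x v u w
      = 2 * (σ x u * h.val x v w - σ x v * h.val x u w)

/-- The Faraday form `F_{ij} = (1/2) R_{ijp}^p`: the curvature of the connection which `D` induces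
on the line bundle of `(-1/2)`-densities. -/
def faraday (D : Connection 2 M) (x : M) (u v : TangentSpace (𝓡 2) x) : ℝ :=
  1 / 2 * ∑ p, (frame x).repr (curvature D x u v (frame x p)) p

namespace AHStructure

/-- The AH structure has Riemannian signature. -/
def IsRiemannian (A : AHStructure M) : Prop :=
  ∀ h ∈ A.conf, ∀ x u, u ≠ 0 → 0 < h.val x u u

/-- `D` is the aligned representative of the AH structure: the (unique) element of the projective
structure with `2 h^{pq} ∇_p h_{qi} = h^{pq} ∇_i h_{pq}` for every `h` in the conformal
structure. -/
def IsAligned (A : AHStructure M) (D : Connection 2 M) : Prop :=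
  D ∈ A.proj ∧ ∀ h ∈ A.conf, ∀ x u,
    2 * metricTrace h.form x (fun a b ↦ covDeriv₂ D h.form x a b u)
      = metricTrace h.form x (covDeriv₂ D h.form x u)

/-- `h` is a distinguished representative of the AH structure: a metric in the conformal structure
whose determinant, a density of weight two, is parallel for the aligned representative. -/
def IsDistinguished (A : AHStructure M) (h : Metric 2 M) : Prop :=
  h ∈ A.conf ∧ ∃ D, A.IsAligned D ∧ ∀ x u, densityDeriv D h 2 (fun _ ↦ 1) x u = 0

/-- An AH structure is exact if it has a distinguished representative. -/
def IsExact (A : AHStructure M) : Prop := ∃ h, A.IsDistinguished h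

/-- An AH structure is Einstein if, for its aligned representative `∇`,

* the symmetric trace-free part of the Ricci curvature vanishes (the structure is naive Einstein);
* the conservation condition `∇_i R + 2 ∇^p F_{ip} = 0` holds, in which the weighted scalar
  curvature `R = |det h|^{1/2} h^{ij} R_{ij}` is a density of weight one and the index `p` is
  raised with the weighted tensor `|det h|^{1/2} h^{pq}`, which do not depend on the choice of `h`
  in the conformal structure. Here the factor `|det h|^{1/2}` is divided out. -/
def IsEinstein (A : AHStructure M) : Prop :=
  ∃ D, A.IsAligned D ∧ ∀ h ∈ A.conf,
    (∀ x u v, (ricci D x u v + ricci D x v u) / 2 = 1 / 2 * scalar D h x * h.val x u v) ∧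
    (∀ x u, densityDeriv D h 1 (scalar D h) x u
      + 2 * metricTrace h.form x (fun a b ↦ covDeriv₂ D (faraday D) x a u b) = 0)

end AHStructure

end AH

/-! ### Para-Kähler manifolds -/

section ParaKahler

variable {m : ℕ} {N : Type*} [TopologicalSpace N] [ChartedSpace (EuclideanSpace ℝ (Fin m)) N]
  [IsManifold (𝓡 m) ∞ N]

variable (m N) in
/-- A para-Kähler structure: a metric `g` with its Levi-Civita connection, and a parallel
endomorphism `J` with `J ∘ J = 1`, for which `Ω(u, v) = g(J u, v)` is skew-symmetric. (It follows
that `g(J u, J v) = - g(u, v)`, that `g` has split signature, that `Ω` is symplectic and that the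
eigenbundles of `J` have the same rank and are integrable.) -/
structure ParaKahlerStructure where
  /-- The metric. -/
  g : Metric m N
  /-- The Levi-Civita connection of the metric. -/
  cov : Connection m N
  /-- The para-complex structure. -/
  J : Π x : N, TangentSpace (𝓡 m) x →L[ℝ] TangentSpace (𝓡 m) x
  isLeviCivita : IsLeviCivita g cov
  smooth_J : ContMDiff (𝓡 m)
    ((𝓡 m).prod 𝓘(ℝ, EuclideanSpace ℝ (Fin m) →L[ℝ] EuclideanSpace ℝ (Fin m))) ∞
    (fun x ↦ TotalSpace.mk' (EuclideanSpace ℝ (Fin m) →L[ℝ] EuclideanSpace ℝ (Fin m)) x (J x))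
  J_J : ∀ x u, J x (J x u) = u
  skew : ∀ x u v, g.val x (J x u) v = - g.val x (J x v) u
  parallel : ∀ (x : N) (Y : Π y : N, TangentSpace (𝓡 m) y), DiffAt Y x → ∀ u,
    cov (fun y ↦ J y (Y y)) x u = J x (cov Y x u)

/-- The symplectic form `Ω_{ij} = J_i^p g_{pj}`. -/
def ParaKahlerStructure.Ω (P : ParaKahlerStructure m N) (x : N) (u v : TangentSpace (𝓡 m) x) : ℝ :=
  P.g.val x (P.J x u) v

/-- Constant para-holomorphic sectional curvature `4c`: the curvature has the form
`R_{ijk}^l = 2c (δ_{[i}^l g_{j]k} - J_{[i}^l Ω_{j]k} + Ω_{ij} J_k^l)`. -/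
def ParaKahlerStructure.HasConstantCurvature (P : ParaKahlerStructure m N) (c : ℝ) : Prop :=
  ∀ x u v w, curvature P.cov x u v w =
    c • (P.g.val x v w • u - P.g.val x u w • v
      - (P.Ω x v w • P.J x u - P.Ω x u w • P.J x v) + (2 * P.Ω x u v) • P.J x w)

end ParaKahler

/-! ### Immersed surfaces in para-Kähler manifolds -/

section Immersion

variable {n m : ℕ}
  {M : Type*} [TopologicalSpace M] [ChartedSpace (EuclideanSpace ℝ (Fin n)) M]
  [IsManifold (𝓡 n) ∞ M]
  {N : Type*} [TopologicalSpace N] [ChartedSpace (EuclideanSpace ℝ (Fin m)) N]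
  [IsManifold (𝓡 m) ∞ N]

/-- The covariant derivative `D_u W` at `x` of a vector field `W` along a map `f : M → N`, for the
connection pulled back from `D`. In the local frame `s_a` of the tangent bundle of `N` given by its
trivialization at `f x`, write `W = W^a (s_a ∘ f)`; then
`D_u W = dW^a(u) s_a + W^a D_{df(u)} s_a`. -/
def covAlong (D : Connection m N) (f : M → N) (W : Π x : M, TangentSpace (𝓡 m) (f x)) (x : M)
    (u : TangentSpace (𝓡 n) x) : TangentSpace (𝓡 m) (f x) :=
  let e := trivializationAt (EuclideanSpace ℝ (Fin m)) (TangentSpace (𝓡 m) : N → Type _) (f x)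
  let w : M → EuclideanSpace ℝ (Fin m) :=
    fun y ↦ (e (TotalSpace.mk' (EuclideanSpace ℝ (Fin m)) (f y) (W y))).2
  e.symm (f x) (mvfderiv (𝓡 n) w x u)
    + D (fun q ↦ e.symm q (w x)) (f x) (mfderiv (𝓡 n) (𝓡 m) f x u)

/-- The bilinear form `f^* g` induced on `M` by the map `f` and the metric `g`. -/
def inducedForm (g : Metric m N) (f : M → N) : Form₂ n M :=
  fun x u v ↦ g.val (f x) (mfderiv (𝓡 n) (𝓡 m) f x u) (mfderiv (𝓡 n) (𝓡 m) f x v)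

/-- The map `f` is spacelike: the induced form is positive definite. -/
def IsSpacelike (g : Metric m N) (f : M → N) : Prop :=
  ∀ (x : M) (u : TangentSpace (𝓡 n) x), u ≠ 0 → 0 < inducedForm g f x u u

/-- The map `f` is isotropic: `f^* Ω = 0`. An immersion of an `n`-manifold in a `2n`-manifold is
Lagrangian if it is isotropic. -/
def IsIsotropic (P : ParaKahlerStructure m N) (f : M → N) : Prop :=
  ∀ (x : M) (u v : TangentSpace (𝓡 n) x),
    P.Ω (f x) (mfderiv (𝓡 n) (𝓡 m) f x u) (mfderiv (𝓡 n) (𝓡 m) f x v) = 0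

/-- The second fundamental form `Π(u, v)` of an immersion `f` with non-degenerate induced metric
`h = f^* g`: the component normal to `f` of `W = D_u (df V)`, where `D` is the Levi-Civita
connection of `g` and `V` extends `v`, that is, `Π(u, v) = W - h^{pq} g(W, df e_p) df e_q`. -/
def secondFundamentalForm (g : Metric m N) (D : Connection m N) (f : M → N)
    (x : M) (u v : TangentSpace (𝓡 n) x) : TangentSpace (𝓡 m) (f x) :=
  let W := covAlong D f (fun y ↦ mfderiv (𝓡 n) (𝓡 m) f y (ext v y)) x u
  W - metricTrace (inducedForm g f) x fun a b : TangentSpace (𝓡 n) x ↦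
    g.val (f x) W (mfderiv (𝓡 n) (𝓡 m) f x a) • mfderiv (𝓡 n) (𝓡 m) f x b

variable (n) in
/-- The mean curvature vector `h^{pq} Π_{pq}`, where `h = f^* g`. -/
def meanCurvature (g : Metric m N) (D : Connection m N) (f : M → N) (x : M) :
    TangentSpace (𝓡 m) (f x) :=
  metricTrace (n := n) (inducedForm g f) x (secondFundamentalForm g D f x)

/-- The second fundamental form as a covariant three-tensor, `Π(u, v, w) = Ω(Π(u, v), df w)`. -/
def secondFundamentalForm₃ (P : ParaKahlerStructure m N) (f : M → N) (x : M)
    (u v w : TangentSpace (𝓡 n) x) : ℝ :=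
  P.Ω (f x) (secondFundamentalForm P.g P.cov f x u v) (mfderiv (𝓡 n) (𝓡 m) f x w)

/-- The mean curvature one-form `H_i = Π_{ipq} h^{pq}`. -/
def meanCurvatureForm (P : ParaKahlerStructure m N) (f : M → N) (x : M)
    (u : TangentSpace (𝓡 n) x) : ℝ :=
  metricTrace (inducedForm P.g f) x (secondFundamentalForm₃ P f x u)

/-- The completely trace-free part `B_{ijk} = Π_{ijk} - (3/(n+2)) H_{(i} h_{jk)}` of the second
fundamental form of a Lagrangian immersion. -/
def cubicForm (P : ParaKahlerStructure m N) (f : M → N) (x : M)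
    (u v w : TangentSpace (𝓡 n) x) : ℝ :=
  secondFundamentalForm₃ P f x u v w - 1 / ((n : ℝ) + 2) *
    (meanCurvatureForm P f x u * inducedForm P.g f x v w
      + meanCurvatureForm P f x v * inducedForm P.g f x w u
      + meanCurvatureForm P f x w * inducedForm P.g f x u v)

/-- `D'` is the connection `D - B_{ijp} h^{pk}`, where `h = f^* g`. -/
def IsInducedConnection (P : ParaKahlerStructure m N) (f : M → N) (D D' : Connection n M) : Prop :=
  ∀ (x : M) (Y : Π y : M, TangentSpace (𝓡 n) y), DiffAt Y x → ∀ u w : TangentSpace (𝓡 n) x,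
    inducedForm P.g f x (D' Y x u) w = inducedForm P.g f x (D Y x u) w - cubicForm P f x u (Y x) w

end Immersion

end ParaKahlerAH

end

open Bundle
open scoped Manifold ContDiff Topology

noncomputable section

namespace ParaKahlerAH

/-! ### Derivatives of vector-valued functions -/

section Calculus

variable {n : ℕ} {M : Type*} [TopologicalSpace M] [ChartedSpace (EuclideanSpace ℝ (Fin n)) M]
  {F G : Type*} [NormedAddCommGroup F] [NormedSpace ℝ F] [NormedAddCommGroup G] [NormedSpace ℝ G]

/-! Since `f` is spacelike and isotropic, `J df(TM)` is orthogonal to `df(TM)`, and by dimension the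
tangent space of `N` along `f` is `df(TM) ⊕ J df(TM)`. The endomorphism `1 - J` kills the `+1`
eigenbundle of `J` and has image in the `-1` eigenbundle. So `(1 - J) ∘ df` identifies `TM` with the
`-1` eigenbundle along `f`, with inverse induced by `projSub 1`, the projection onto `TM` along the
`+1` eigenbundle. As `J` is parallel, both eigenbundles are preserved by the pulled back connection.
The connection `∇ = D - B` is exactly what it induces on the `-1` eigenbundle, transported to `TM`.
Both `D` and `∇` belong to one family `conn ε`, namely the orthogonal projection of `(1 - ε J)`
applied to the ambient derivative, with `ε = 0` giving `D` and `ε = 1` giving `∇`.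

Two facts carry the theorem. First, `∇h = 2 Π` (`covDeriv₂_conn`). The tensor `Π` is completely
symmetric, because the ambient connection is torsion-free and because of the derivative of `f^*Ω =
0`, and it is trace-free because the mean curvature vanishes. Symmetry of `∇h` is the compatibility
of an AH structure; its vanishing traces make `∇` aligned and `h` distinguished.

Second, the curvature of `∇` is the ambient curvature, restricted to `df(TM)` and projected
(`curvature_conn`). All terms of the constant curvature formula that contain `J` carry a factor
`f^*Ω = 0`, so `R(u, v) w = c (h(v, w) u - h(u, w) v)` (`curvature_conn_eq`). Hence on a surface the
Ricci tensor is `c h`, the Faraday form is zero and the scalar trace is `2 c`; the density `2c |det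
h|^{1/2}` is parallel, which is the conservation condition.

Most of the work is the calculus of fields along maps. It is done in coordinates: in a fixed
preferred chart a connection is `d + Γ`, with `Γ` a function valued in a fixed vector space, so that
smoothness, the symmetry of the second fundamental form and the pulled back curvature reduce to the
product rule and to equality of mixed derivatives. -/

theorem hasMFDerivAt_mvfderiv {w : M → F} {x : M}
    (hw : MDifferentiableAt (𝓡 n) 𝓘(ℝ, F) w x) :
    HasMFDerivAt (𝓡 n) 𝓘(ℝ, F) w x (mvfderiv (𝓡 n) w x) :=
  hw.hasMFDerivAt

theorem mvfderiv_eq_of_hasMFDerivAt {w : M → F} {x : M}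
    {w' : TangentSpace (𝓡 n) x →L[ℝ] F} (hw : HasMFDerivAt (𝓡 n) 𝓘(ℝ, F) w x w') :
    mvfderiv (𝓡 n) w x = w' :=
  hw.mfderiv

theorem mvfderiv_congr {w w' : M → F} {x : M} (h : w =ᶠ[𝓝 x] w') :
    mvfderiv (𝓡 n) w x = mvfderiv (𝓡 n) w' x :=
  h.mfderiv_eq

theorem mvfderiv_clm_apply {A : M → F →L[ℝ] G} {w : M → F} {x : M}
    (hA : MDifferentiableAt (𝓡 n) 𝓘(ℝ, F →L[ℝ] G) A x)
    (hw : MDifferentiableAt (𝓡 n) 𝓘(ℝ, F) w x) (u : TangentSpace (𝓡 n) x) :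
    mvfderiv (𝓡 n) (fun y ↦ A y (w y)) x u
      = mvfderiv (𝓡 n) A x u (w x) + A x (mvfderiv (𝓡 n) w x u) := by
  have h : HasMFDerivAt (𝓡 n) 𝓘(ℝ, G) (fun y ↦ A y (w y)) x
      ((ContinuousLinearMap.apply ℝ G (w x)).comp (mvfderiv (𝓡 n) A x)
        + (A x).comp (mvfderiv (𝓡 n) w x)) := by
    refine ⟨hA.continuousAt.clm_apply hw.continuousAt, ?_⟩
    convert! (hasMFDerivAt_mvfderiv hA).2.clm_apply (hasMFDerivAt_mvfderiv hw).2 using 1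
    simp [writtenInExtChartAt, add_comm]
    rfl
  rw [mvfderiv_eq_of_hasMFDerivAt h]
  rfl

theorem mvfderiv_comp_map {m : ℕ} {N : Type*} [TopologicalSpace N]
    [ChartedSpace (EuclideanSpace ℝ (Fin m)) N] {w : N → F} {f : M → N} {x : M}
    (hw : MDifferentiableAt (𝓡 m) 𝓘(ℝ, F) w (f x)) (hf : MDifferentiableAt (𝓡 n) (𝓡 m) f x)
    (u : TangentSpace (𝓡 n) x) :
    mvfderiv (𝓡 n) (fun y ↦ w (f y)) x u
      = mvfderiv (𝓡 m) w (f x) (mfderiv (𝓡 n) (𝓡 m) f x u) :=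
  mfderiv_comp_apply x hw hf u

/-- The domain is finite-dimensional, so `A` is a finite sum of its values on basis vectors times
the coordinate functionals. -/
theorem contMDiffAt_clm_of_apply {k : ℕ} {r : ℕ∞ω}
    {A : M → EuclideanSpace ℝ (Fin k) →L[ℝ] F} {x : M}
    (h : ∀ v, ContMDiffAt (𝓡 n) 𝓘(ℝ, F) r (fun y ↦ A y v) x) :
    ContMDiffAt (𝓡 n) 𝓘(ℝ, EuclideanSpace ℝ (Fin k) →L[ℝ] F) r A x := by
  have hA : A = fun y ↦ ∑ i, ContinuousLinearMap.smulRightL ℝ (EuclideanSpace ℝ (Fin k)) F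
      (EuclideanSpace.proj i) (A y (EuclideanSpace.basisFun (Fin k) ℝ i)) := by
    ext y v
    conv_lhs => rw [← (EuclideanSpace.basisFun (Fin k) ℝ).sum_repr v]
    simp
  rw [hA]
  refine ContMDiffAt.sum fun i _ ↦ ?_
  exact (ContinuousLinearMap.contMDiff _).contMDiffAt.comp x (h _)

end Calculus

/-! ### Coordinate frames -/

theorem fderiv_apply_const {E F G : Type*} [NormedAddCommGroup E] [NormedSpace ℝ E]
    [NormedAddCommGroup F] [NormedSpace ℝ F] [NormedAddCommGroup G] [NormedSpace ℝ G]
    {A : E → F →L[ℝ] G} {z : E} (hA : DifferentiableAt ℝ A z) (a : F) (b : E) :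
    fderiv ℝ (fun z ↦ A z a) z b = fderiv ℝ A z b a := by
  rw [fderiv_clm_apply hA (differentiableAt_const a)]
  simp

theorem lieBracketWithin_eq_zero_of_eventuallyEq_const {E : Type*} [NormedAddCommGroup E]
    [NormedSpace ℝ E] {V W : E → E} {z a b : E} (hV : V =ᶠ[𝓝 z] fun _ ↦ a)
    (hW : W =ᶠ[𝓝 z] fun _ ↦ b) : VectorField.lieBracketWithin ℝ V W Set.univ z = 0 := by
  rw [VectorField.lieBracketWithin_univ, hV.lieBracket_vectorField_eq hW, VectorField.lieBracket]
  simp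

section Frames

variable {n : ℕ} {M : Type*} [TopologicalSpace M] [ChartedSpace (EuclideanSpace ℝ (Fin n)) M]

variable (n) in
theorem eventually_mem_source (x : M) :
    ∀ᶠ y in 𝓝 x, y ∈ (chartAt (EuclideanSpace ℝ (Fin n)) x).source :=
  (chartAt (EuclideanSpace ℝ (Fin n)) x).open_source.mem_nhds (mem_chart_source _ x)

variable [IsManifold (𝓡 n) ∞ M]

/-- The coordinates of tangent vectors at `y` in the preferred chart at `x`. -/
abbrev coord (x y : M) : TangentSpace (𝓡 n) y →L[ℝ] EuclideanSpace ℝ (Fin n) :=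
  (trivializationAt (EuclideanSpace ℝ (Fin n)) (TangentSpace (𝓡 n) : M → Type _)
    x).continuousLinearMapAt ℝ y

/-- The tangent vector at `y` with given coordinates in the preferred chart at `x`. -/
abbrev coordSymm (x y : M) : EuclideanSpace ℝ (Fin n) →L[ℝ] TangentSpace (𝓡 n) y :=
  (trivializationAt (EuclideanSpace ℝ (Fin n)) (TangentSpace (𝓡 n) : M → Type _) x).symmL ℝ y

theorem coord_eq {x y : M} (hy : y ∈ (chartAt (EuclideanSpace ℝ (Fin n)) x).source)
    (v : TangentSpace (𝓡 n) y) :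
    coord x y v = (trivializationAt (EuclideanSpace ℝ (Fin n)) (TangentSpace (𝓡 n) : M → Type _) x
      (TotalSpace.mk' (EuclideanSpace ℝ (Fin n)) y v)).2 :=
  Trivialization.continuousLinearMapAt_apply_of_mem _ _ hy v

theorem coordSymm_coord {x y : M} (hy : y ∈ (chartAt (EuclideanSpace ℝ (Fin n)) x).source)
    (v : TangentSpace (𝓡 n) y) : coordSymm x y (coord x y v) = v :=
  Trivialization.symmL_continuousLinearMapAt (R := ℝ) _ hy v

theorem coord_coordSymm {x y : M} (hy : y ∈ (chartAt (EuclideanSpace ℝ (Fin n)) x).source)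
    (v : EuclideanSpace ℝ (Fin n)) : coord x y (coordSymm x y v) = v :=
  Trivialization.continuousLinearMapAt_symmL (R := ℝ) _ hy v

theorem coord_self (x : M) (v : TangentSpace (𝓡 n) x) : coord x x v = v := by
  rw [coord, TangentBundle.continuousLinearMapAt_trivializationAt_eq_core (mem_chart_source _ x)]
  exact (tangentBundleCore (𝓡 n) M).coordChange_self (achart _ x) x (mem_chart_source _ x) v

theorem trivializationAt_symm_eq {x y : M}
    (hy : y ∈ (chartAt (EuclideanSpace ℝ (Fin n)) x).source) (v : EuclideanSpace ℝ (Fin n)) :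
    (trivializationAt (EuclideanSpace ℝ (Fin n)) (TangentSpace (𝓡 n) : M → Type _) x).symm y v
      = coordSymm x y v :=
  (Trivialization.symmL_apply _ hy v).symm

theorem ext_eq_coordSymm {x y : M} (hy : y ∈ (chartAt (EuclideanSpace ℝ (Fin n)) x).source)
    (v : TangentSpace (𝓡 n) x) : ext v y = coordSymm x y v := by
  change (trivializationAt (EuclideanSpace ℝ (Fin n)) (TangentSpace (𝓡 n) : M → Type _) x).symm y _
    = _
  rw [trivializationAt_symm_eq hy, ← coord_eq (mem_chart_source (EuclideanSpace ℝ (Fin n)) x) v,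
    coord_self]

theorem ext_eventuallyEq {x : M} (v : TangentSpace (𝓡 n) x) :
    ∀ᶠ y in 𝓝 x, ext v y = coordSymm x y v := by
  filter_upwards [eventually_mem_source n x] with y hy using ext_eq_coordSymm hy v

theorem coord_ext {x y : M} (hy : y ∈ (chartAt (EuclideanSpace ℝ (Fin n)) x).source)
    (v : TangentSpace (𝓡 n) x) : coord x y (ext v y) = v := by
  rw [ext_eq_coordSymm hy]
  exact coord_coordSymm hy v

theorem ext_self {x : M} (v : TangentSpace (𝓡 n) x) : ext v x = v :=
  FiberBundle.extend_apply_self _ v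

/-- The vector fields with constant coordinates in a preferred chart are smooth there. -/
theorem contMDiffAt_coordSymm {x y : M} (r : ℕ∞ω) (hr : r ≤ ∞)
    (hy : y ∈ (chartAt (EuclideanSpace ℝ (Fin n)) x).source) (v : EuclideanSpace ℝ (Fin n)) :
    ContMDiffAt (𝓡 n) ((𝓡 n).prod 𝓘(ℝ, EuclideanSpace ℝ (Fin n))) r
      (fun z ↦ TotalSpace.mk' (EuclideanSpace ℝ (Fin n)) z (coordSymm x z v)) y := by
  refine ContMDiffAt.of_le (n := ∞) ?_ hr
  rw [(trivializationAt (EuclideanSpace ℝ (Fin n)) (TangentSpace (𝓡 n) : M → Type _)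
    x).contMDiffAt_section_iff hy]
  refine (contMDiffAt_const (c := v)).congr_of_eventuallyEq ?_
  filter_upwards [(chartAt (EuclideanSpace ℝ (Fin n)) x).open_source.mem_nhds hy] with z hz
  exact (coord_eq hz _).symm.trans (coord_coordSymm hz v)

theorem contMDiffAt_ext {x : M} (r : ℕ∞ω) (hr : r ≤ ∞) (v : TangentSpace (𝓡 n) x) :
    ContMDiffAt (𝓡 n) ((𝓡 n).prod 𝓘(ℝ, EuclideanSpace ℝ (Fin n))) r
      (fun z ↦ TotalSpace.mk' (EuclideanSpace ℝ (Fin n)) z (ext v z)) x := by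
  refine (contMDiffAt_coordSymm r hr (mem_chart_source _ x) v).congr_of_eventuallyEq ?_
  filter_upwards [ext_eventuallyEq v] with y hy
  rw [hy]

theorem diffAt_ext {x : M} (v : TangentSpace (𝓡 n) x) : DiffAt (ext v) x :=
  (contMDiffAt_ext 1 (by norm_cast) v).mdifferentiableAt one_ne_zero

/-- On the chart domain, `ext v` is the image of the constant field `v` under the derivative of the
inverse chart; the rest is the chain rule. -/
theorem mvfderiv_ext {F : Type*} [NormedAddCommGroup F] [NormedSpace ℝ F] {φ : M → F} {x y : M}
    (hy : y ∈ (chartAt (EuclideanSpace ℝ (Fin n)) x).source)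
    (hφ : MDifferentiableAt (𝓡 n) 𝓘(ℝ, F) φ y) (v : TangentSpace (𝓡 n) x) :
    mvfderiv (𝓡 n) φ y (ext v y)
      = fderiv ℝ (φ ∘ (extChartAt (𝓡 n) x).symm) (extChartAt (𝓡 n) x y) v := by
  have hy' : y ∈ (extChartAt (𝓡 n) x).source := by rwa [extChartAt_source]
  have h1 := mdifferentiableWithinAt_extChartAt_symm (I := 𝓡 n)
    ((extChartAt (𝓡 n) x).map_source hy')
  rw [ModelWithCorners.range_eq_univ, mdifferentiableWithinAt_univ] at h1
  have h2 : MDifferentiableAt (𝓡 n) 𝓘(ℝ, F) φ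
      ((extChartAt (𝓡 n) x).symm (extChartAt (𝓡 n) x y)) := by
    rwa [(extChartAt (𝓡 n) x).left_inv hy']
  have h3 : coordSymm x y = _ := TangentBundle.symmL_trivializationAt hy
  rw [ext_eq_coordSymm hy, h3, ModelWithCorners.range_eq_univ, mfderivWithin_univ,
    ← mfderiv_eq_fderiv]
  erw [mfderiv_comp_apply _ h2 h1]
  rw [(extChartAt (𝓡 n) x).left_inv hy']
  rfl

theorem mvfderiv_eq_fderiv {F : Type*} [NormedAddCommGroup F] [NormedSpace ℝ F] {φ : M → F} {x : M}
    (hφ : MDifferentiableAt (𝓡 n) 𝓘(ℝ, F) φ x) (v : TangentSpace (𝓡 n) x) :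
    mvfderiv (𝓡 n) φ x v
      = fderiv ℝ (φ ∘ (extChartAt (𝓡 n) x).symm) (extChartAt (𝓡 n) x x) v := by
  rw [← mvfderiv_ext (mem_chart_source _ x) hφ v, ext_self]

theorem contDiffAt_comp_extChartAt_symm {F : Type*} [NormedAddCommGroup F] [NormedSpace ℝ F]
    {φ : M → F} {x : M} {r : ℕ∞ω} (hr : r ≤ ∞) (hφ : ContMDiffAt (𝓡 n) 𝓘(ℝ, F) r φ x) :
    ContDiffAt ℝ r (φ ∘ (extChartAt (𝓡 n) x).symm) (extChartAt (𝓡 n) x x) := by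
  have h1 := contMDiffWithinAt_extChartAt_symm_range (n := ∞) (I := 𝓡 n) x
    ((extChartAt (𝓡 n) x).map_source (mem_extChartAt_source x))
  rw [ModelWithCorners.range_eq_univ, contMDiffWithinAt_univ] at h1
  refine ContMDiffAt.contDiffAt (ContMDiffAt.comp _ ?_ (h1.of_le hr))
  rwa [extChartAt_to_inv]

/-- The field `y ↦ dφ(V)`, where `V` is smooth. -/
theorem contMDiffAt_mvfderiv_apply {F : Type*} [NormedAddCommGroup F] [NormedSpace ℝ F]
    {φ : M → F} {x : M} {r s : ℕ∞ω} (hφ : ContMDiffAt (𝓡 n) 𝓘(ℝ, F) s φ x) (hrs : r + 1 ≤ s)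
    {V : Π y : M, TangentSpace (𝓡 n) y}
    (hV : ContMDiffAt (𝓡 n) ((𝓡 n).prod 𝓘(ℝ, EuclideanSpace ℝ (Fin n))) r
      (fun z ↦ TotalSpace.mk' (EuclideanSpace ℝ (Fin n)) z (V z)) x) :
    ContMDiffAt (𝓡 n) 𝓘(ℝ, F) r (fun y ↦ mvfderiv (𝓡 n) φ y (V y)) x := by
  have h := ContMDiffAt.clm_apply_of_inCoordinates (b₁ := id)
    (ContMDiffAt.mfderiv_const hφ hrs) hV (hφ.of_le (le_self_add.trans hrs))
  exact (contMDiff_snd_tangentBundle_modelSpace F 𝓘(ℝ, F)).contMDiffAt.comp x h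

/-- Second derivatives are symmetric. -/
theorem mvfderiv_mvfderiv_ext_comm {F : Type*} [NormedAddCommGroup F] [NormedSpace ℝ F]
    {φ : M → F} {x : M} (hφ : ContMDiffAt (𝓡 n) 𝓘(ℝ, F) 2 φ x) (u v : TangentSpace (𝓡 n) x) :
    mvfderiv (𝓡 n) (fun y ↦ mvfderiv (𝓡 n) φ y (ext v y)) x u
      = mvfderiv (𝓡 n) (fun y ↦ mvfderiv (𝓡 n) φ y (ext u y)) x v := by
  have hc := contDiffAt_comp_extChartAt_symm (by norm_cast) hφ
  have hfd : DifferentiableAt ℝ (fderiv ℝ (φ ∘ (extChartAt (𝓡 n) x).symm))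
      (extChartAt (𝓡 n) x x) :=
    (hc.fderiv_right (m := 1) (by norm_num)).differentiableAt one_ne_zero
  have key : ∀ a b : TangentSpace (𝓡 n) x,
      mvfderiv (𝓡 n) (fun y ↦ mvfderiv (𝓡 n) φ y (ext a y)) x b
        = fderiv ℝ (fderiv ℝ (φ ∘ (extChartAt (𝓡 n) x).symm)) (extChartAt (𝓡 n) x x) b a := by
    intro a b
    have hd : MDifferentiableAt (𝓡 n) 𝓘(ℝ, F) (fun y ↦ mvfderiv (𝓡 n) φ y (ext a y)) x :=
      (contMDiffAt_mvfderiv_apply (r := 1) hφ (by norm_num)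
        (contMDiffAt_ext 1 (by norm_cast) a)).mdifferentiableAt one_ne_zero
    rw [mvfderiv_eq_fderiv hd]
    -- Read in the chart, the inner derivative is an ordinary directional derivative on a whole
    -- neighbourhood, so it can be differentiated again.
    have hev : (fun y ↦ mvfderiv (𝓡 n) φ y (ext a y)) ∘ (extChartAt (𝓡 n) x).symm
        =ᶠ[𝓝 (extChartAt (𝓡 n) x x)]
          fun z ↦ fderiv ℝ (φ ∘ (extChartAt (𝓡 n) x).symm) z a := by
      have h1 : ∀ᶠ y in 𝓝 x, y ∈ (chartAt (EuclideanSpace ℝ (Fin n)) x).source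
          ∧ MDifferentiableAt (𝓡 n) 𝓘(ℝ, F) φ y := by
        filter_upwards [eventually_mem_source n x,
          (contMDiffAt_iff_contMDiffAt_nhds (by norm_num)).1 hφ] with y h1 h2
        exact ⟨h1, h2.mdifferentiableAt two_ne_zero⟩
      have h2 := (continuousAt_extChartAt_symm (I := 𝓡 n) x)
      rw [ContinuousAt, extChartAt_to_inv] at h2
      filter_upwards [h2.eventually h1, extChartAt_target_mem_nhds (I := 𝓡 n) x] with z hz hz'
      rw [Function.comp_apply, mvfderiv_ext hz.1 hz.2, (extChartAt (𝓡 n) x).right_inv hz']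
    rw [hev.fderiv_eq]
    exact fderiv_apply_const hfd a b
  rw [key, key]
  exact (hc.isSymmSndFDerivAt (by simp)).eq u v

/-- Coordinate vector fields commute. -/
theorem mlieBracket_ext_ext {x : M} (u v : TangentSpace (𝓡 n) x) :
    VectorField.mlieBracket (𝓡 n) (ext u) (ext v) x = 0 := by
  let W (a : TangentSpace (𝓡 n) x) : EuclideanSpace ℝ (Fin n) → EuclideanSpace ℝ (Fin n) :=
    VectorField.mpullbackWithin 𝓘(ℝ, EuclideanSpace ℝ (Fin n)) (𝓡 n) (extChartAt (𝓡 n) x).symm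
        (ext a) (Set.range (𝓡 n))
  -- The manifold bracket is by definition the bracket of the fields pulled back to the chart, and
  -- these are constant.
  have key : ∀ a : TangentSpace (𝓡 n) x, W a =ᶠ[𝓝 (extChartAt (𝓡 n) x x)] fun _ ↦ a := by
    intro a
    filter_upwards [extChartAt_target_mem_nhds (I := 𝓡 n) x] with z hz
    have hy : (extChartAt (𝓡 n) x).symm z ∈ (chartAt (EuclideanSpace ℝ (Fin n)) x).source := by
      rw [← extChartAt_source (𝓡 n)]
      exact (extChartAt (𝓡 n) x).map_target hz
    have h3 : coordSymm x ((extChartAt (𝓡 n) x).symm z) = _ :=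
      TangentBundle.symmL_trivializationAt hy
    rw [(extChartAt (𝓡 n) x).right_inv hz] at h3
    change (mfderivWithin _ _ (extChartAt (𝓡 n) x).symm (Set.range (𝓡 n)) z).inverse
      (ext a ((extChartAt (𝓡 n) x).symm z)) = a
    rw [ext_eq_coordSymm hy, h3]
    exact (isInvertible_mfderivWithin_extChartAt_symm hz).inverse_apply_self a
  have h : VectorField.lieBracketWithin ℝ (W u) (W v)
      ((extChartAt (𝓡 n) x).symm ⁻¹' Set.univ ∩ Set.range (𝓡 n)) (extChartAt (𝓡 n) x x) = 0 := by
    rw [Set.preimage_univ, Set.univ_inter, ModelWithCorners.range_eq_univ]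
    exact lieBracketWithin_eq_zero_of_eventuallyEq_const (key u) (key v)
  exact (congrArg (mfderiv (𝓡 n) 𝓘(ℝ, EuclideanSpace ℝ (Fin n)) (extChartAt (𝓡 n) x) x).inverse
    h).trans (map_zero _)

end Frames

/-! ### Vector fields along maps and their covariant derivatives -/

section Along

variable {n m : ℕ}
  {M : Type*} [TopologicalSpace M] [ChartedSpace (EuclideanSpace ℝ (Fin n)) M]
  {N : Type*} [TopologicalSpace N] [ChartedSpace (EuclideanSpace ℝ (Fin m)) N]
  [IsManifold (𝓡 m) ∞ N]

variable (n) in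
/-- The vector field `W` along the map `f` is differentiable at `x`. -/
abbrev DiffAlongAt (f : M → N) (W : Π x : M, TangentSpace (𝓡 m) (f x)) (x : M) : Prop :=
  MDifferentiableAt (𝓡 n) ((𝓡 m).prod 𝓘(ℝ, EuclideanSpace ℝ (Fin m)))
    (fun y ↦ TotalSpace.mk' (EuclideanSpace ℝ (Fin m)) (f y) (W y)) x

variable (n) in
/-- The vector field `W` along the map `f` is smooth at `x`. -/
abbrev SmoothAlongAt (f : M → N) (W : Π x : M, TangentSpace (𝓡 m) (f x)) (x : M) : Prop :=
  ContMDiffAt (𝓡 n) ((𝓡 m).prod 𝓘(ℝ, EuclideanSpace ℝ (Fin m))) ∞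
    (fun y ↦ TotalSpace.mk' (EuclideanSpace ℝ (Fin m)) (f y) (W y)) x

variable {f : M → N} {W : Π x : M, TangentSpace (𝓡 m) (f x)} {x : M} {q : N}

theorem coord_along_eventuallyEq (hf : ContinuousAt f x)
    (hx : f x ∈ (chartAt (EuclideanSpace ℝ (Fin m)) q).source)
    (W : Π x : M, TangentSpace (𝓡 m) (f x)) :
    (fun y ↦ (trivializationAt (EuclideanSpace ℝ (Fin m)) (TangentSpace (𝓡 m) : N → Type _) q
      (TotalSpace.mk' (EuclideanSpace ℝ (Fin m)) (f y) (W y))).2)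
      =ᶠ[𝓝 x] fun y ↦ coord q (f y) (W y) := by
  filter_upwards [hf ((chartAt (EuclideanSpace ℝ (Fin m)) q).open_source.mem_nhds hx)] with y hy
  exact (coord_eq hy _).symm

theorem diffAlongAt_iff (hx : f x ∈ (chartAt (EuclideanSpace ℝ (Fin m)) q).source) :
    DiffAlongAt n f W x ↔ MDifferentiableAt (𝓡 n) (𝓡 m) f x ∧
      MDifferentiableAt (𝓡 n) 𝓘(ℝ, EuclideanSpace ℝ (Fin m)) (fun y ↦ coord q (f y) (W y)) x := by
  have he : TotalSpace.mk' (EuclideanSpace ℝ (Fin m)) (f x) (W x) ∈ (trivializationAt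
      (EuclideanSpace ℝ (Fin m)) (TangentSpace (𝓡 m) : N → Type _) q).source :=
    (Trivialization.mem_source _).2 hx
  refine (Trivialization.mdifferentiableAt_totalSpace_iff (𝓡 m) _
    (fun y ↦ TotalSpace.mk' (EuclideanSpace ℝ (Fin m)) (f y) (W y)) he).trans
    (and_congr_right fun hf ↦ ?_)
  have h := coord_along_eventuallyEq hf.continuousAt hx W
  exact ⟨fun h' ↦ h'.congr_of_eventuallyEq h.symm, fun h' ↦ h'.congr_of_eventuallyEq h⟩

theorem smoothAlongAt_iff (hx : f x ∈ (chartAt (EuclideanSpace ℝ (Fin m)) q).source) :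
    SmoothAlongAt n f W x ↔ ContMDiffAt (𝓡 n) (𝓡 m) ∞ f x ∧
      ContMDiffAt (𝓡 n) 𝓘(ℝ, EuclideanSpace ℝ (Fin m)) ∞ (fun y ↦ coord q (f y) (W y)) x := by
  have he : TotalSpace.mk' (EuclideanSpace ℝ (Fin m)) (f x) (W x) ∈ (trivializationAt
      (EuclideanSpace ℝ (Fin m)) (TangentSpace (𝓡 m) : N → Type _) q).source :=
    (Trivialization.mem_source _).2 hx
  refine (Trivialization.contMDiffAt_iff
    (f := fun y ↦ TotalSpace.mk' (EuclideanSpace ℝ (Fin m)) (f y) (W y)) he).trans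
    (and_congr_right fun hf ↦ ?_)
  have h := coord_along_eventuallyEq hf.continuousAt hx W
  exact ⟨fun h' ↦ h'.congr_of_eventuallyEq h.symm, fun h' ↦ h'.congr_of_eventuallyEq h⟩

theorem SmoothAlongAt.diffAlongAt (h : SmoothAlongAt n f W x) : DiffAlongAt n f W x :=
  h.mdifferentiableAt (by simp)

theorem SmoothAlongAt.eventually_diffAlongAt [IsManifold (𝓡 n) ∞ M] (h : SmoothAlongAt n f W x) :
    ∀ᶠ y in 𝓝 x, DiffAlongAt n f W y := by
  have h1 := (contMDiffAt_iff_contMDiffAt_nhds (n := 1) (by simp)).1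
    (ContMDiffAt.of_le h (by norm_cast))
  filter_upwards [h1] with y hy using hy.mdifferentiableAt one_ne_zero

end Along

/-! ### Connections in coordinates -/

section Christoffel

variable {m : ℕ} {N : Type*} [TopologicalSpace N] [ChartedSpace (EuclideanSpace ℝ (Fin m)) N]
  [IsManifold (𝓡 m) ∞ N]

theorem diffAt_coordSymm {q p : N} (hp : p ∈ (chartAt (EuclideanSpace ℝ (Fin m)) q).source)
    (b : EuclideanSpace ℝ (Fin m)) : DiffAt (fun z ↦ coordSymm q z b) p :=
  (contMDiffAt_coordSymm 1 (by norm_cast) hp b).mdifferentiableAt one_ne_zero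

theorem diffAt_iff {q p : N} {Z : Π p : N, TangentSpace (𝓡 m) p}
    (hp : p ∈ (chartAt (EuclideanSpace ℝ (Fin m)) q).source) :
    DiffAt Z p ↔
      MDifferentiableAt (𝓡 m) 𝓘(ℝ, EuclideanSpace ℝ (Fin m)) (fun y ↦ coord q y (Z y)) p :=
  (diffAlongAt_iff (f := fun p : N ↦ p) hp).trans (and_iff_right mdifferentiableAt_id)

/-- A covariant derivative at a point is a derivative of coordinates plus a zeroth order term. -/
theorem cov_eq_coord (D : Connection m N) {q p : N}
    (hp : p ∈ (chartAt (EuclideanSpace ℝ (Fin m)) q).source) {Z : Π p : N, TangentSpace (𝓡 m) p}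
    (hZ : DiffAt Z p) (X : TangentSpace (𝓡 m) p) :
    D Z p X = coordSymm q p (mvfderiv (𝓡 m) (fun y ↦ coord q y (Z y)) p X)
      + D (fun z ↦ coordSymm q z (coord q p (Z p))) p X := by
  -- The derivative terms in the two Leibniz rules cancel in the difference, which therefore depends
  -- only on `Z p`. It may be evaluated on the field with the same value and constant coordinates,
  -- where the coordinate derivative vanishes.
  have hten : TensorialAt (𝓡 m) (EuclideanSpace ℝ (Fin m))
      (fun Z : Π p : N, TangentSpace (𝓡 m) p ↦
        D Z p X - coordSymm q p (mvfderiv (𝓡 m) (fun y ↦ coord q y (Z y)) p X)) p := by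
    constructor
    · intro φ σ hφ hσ
      have h1 := D.isCovariantDerivativeOn.leibniz hσ hφ (Set.mem_univ p)
      have h2 : (fun y ↦ coord q y ((φ • σ) y)) = fun y ↦ φ y • coord q y (σ y) := by
        funext y; simp
      rw [h1, h2, mvfderiv_fun_smul hφ ((diffAt_iff hp).1 hσ)]
      have h3 := coordSymm_coord hp (σ p)
      simp only [add_apply, smul_apply,
        ContinuousLinearMap.smulRight_apply, map_add, map_smul, h3]
      module
    · intro σ σ' hσ hσ'
      have h1 := D.isCovariantDerivativeOn.add hσ hσ' (Set.mem_univ p)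
      have h2 : (fun y ↦ coord q y ((σ + σ') y)) = fun y ↦ coord q y (σ y) + coord q y (σ' y) := by
        funext y; simp
      rw [h1, h2, mvfderiv_fun_add ((diffAt_iff hp).1 hσ) ((diffAt_iff hp).1 hσ')]
      simp
      module
  have h := hten.pointwise hZ (diffAt_coordSymm hp (coord q p (Z p))) (coordSymm_coord hp _).symm
  have hc : (fun y ↦ coord q y (coordSymm q y (coord q p (Z p))))
      =ᶠ[𝓝 p] fun _ ↦ coord q p (Z p) := by
    filter_upwards [(chartAt (EuclideanSpace ℝ (Fin m)) q).open_source.mem_nhds hp] with y hy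
    exact coord_coordSymm hy _
  have h0 : mvfderiv (𝓡 m) (fun y ↦ coord q y (coordSymm q y (coord q p (Z p)))) p = 0 := by
    rw [mvfderiv_congr hc, mvfderiv_const]
  simp only [h0] at h
  rw [sub_eq_iff_eq_add] at h
  rw [h]
  simp [add_comm]

/-- The Christoffel symbols of a connection in the preferred chart at `q`: in this chart,
`christoffel D q p b a` are the coordinates of the derivative in direction `a` of the field with
constant coordinates `b`. -/
def christoffel (D : Connection m N) (q p : N) :
    EuclideanSpace ℝ (Fin m) →L[ℝ] EuclideanSpace ℝ (Fin m) →L[ℝ] EuclideanSpace ℝ (Fin m) :=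
  ∑ i, (EuclideanSpace.proj i : EuclideanSpace ℝ (Fin m) →L[ℝ] ℝ).smulRight
    ((coord q p).comp ((D (fun z ↦ coordSymm q z (EuclideanSpace.basisFun (Fin m) ℝ i)) p).comp
      (coordSymm q p)))

/-- Linearity over constants. It shows that `christoffel`, defined as a finite sum over a basis in
order to be a bundled linear map, has the expected values. -/
theorem cov_coordSymm_sum (D : Connection m N) {q p : N}
    (hp : p ∈ (chartAt (EuclideanSpace ℝ (Fin m)) q).source) (b : EuclideanSpace ℝ (Fin m)) :
    D (fun z ↦ coordSymm q z b) p
      = ∑ i, b i • D (fun z ↦ coordSymm q z (EuclideanSpace.basisFun (Fin m) ℝ i)) p := by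
  let L : EuclideanSpace ℝ (Fin m) →ₗ[ℝ] (TangentSpace (𝓡 m) p →L[ℝ] TangentSpace (𝓡 m) p) :=
    { toFun := fun b ↦ D (fun z ↦ coordSymm q z b) p
      map_add' := fun b b' ↦ by
        rw [← D.isCovariantDerivativeOn.add (diffAt_coordSymm hp b) (diffAt_coordSymm hp b')
          (Set.mem_univ p)]
        congr 1
        funext z
        exact map_add _ _ _
      map_smul' := fun c b ↦ by
        rw [RingHom.id_apply, ← D.isCovariantDerivativeOn.smul_const c (diffAt_coordSymm hp b)
          (Set.mem_univ p)]
        congr 1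
        funext z
        exact map_smul _ _ _ }
  change L b = ∑ i, b i • L (EuclideanSpace.basisFun (Fin m) ℝ i)
  conv_lhs => rw [← (EuclideanSpace.basisFun (Fin m) ℝ).sum_repr b]
  simp

theorem christoffel_apply (D : Connection m N) {q p : N}
    (hp : p ∈ (chartAt (EuclideanSpace ℝ (Fin m)) q).source) (b a : EuclideanSpace ℝ (Fin m)) :
    christoffel D q p b a = coord q p (D (fun z ↦ coordSymm q z b) p (coordSymm q p a)) := by
  rw [cov_coordSymm_sum D hp b]
  simp [christoffel]

/-- The formula `∇ = d + Γ`. All objects on the right have values in fixed vector spaces, so they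
can be differentiated as the base point moves. -/
theorem coord_cov (D : Connection m N) {q p : N}
    (hp : p ∈ (chartAt (EuclideanSpace ℝ (Fin m)) q).source) {Z : Π p : N, TangentSpace (𝓡 m) p}
    (hZ : DiffAt Z p) (X : TangentSpace (𝓡 m) p) :
    coord q p (D Z p X) = mvfderiv (𝓡 m) (fun y ↦ coord q y (Z y)) p X
      + christoffel D q p (coord q p (Z p)) (coord q p X) := by
  rw [cov_eq_coord D hp hZ, map_add, coord_coordSymm hp, christoffel_apply D hp,
    coordSymm_coord hp]

/-- A smooth connection sends smooth vector fields to smooth fields of endomorphisms; this local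
form follows from the global one by means of bump functions. -/
theorem contMDiffAt_cov [T2Space N] {D : Connection m N} (hD : D.ContMDiffCovariantDerivative ∞)
    {U : Set N} (hU : IsOpen U) {p : N} (hp : p ∈ U) {Z : Π p : N, TangentSpace (𝓡 m) p}
    (hZ : ContMDiffOn (𝓡 m) ((𝓡 m).prod 𝓘(ℝ, EuclideanSpace ℝ (Fin m))) ∞
      (fun y ↦ TotalSpace.mk' (EuclideanSpace ℝ (Fin m)) y (Z y)) U) :
    ContMDiffAt (𝓡 m) ((𝓡 m).prod 𝓘(ℝ, EuclideanSpace ℝ (Fin m) →L[ℝ] EuclideanSpace ℝ (Fin m))) ∞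
      (fun y ↦ TotalSpace.mk' (EuclideanSpace ℝ (Fin m) →L[ℝ] EuclideanSpace ℝ (Fin m))
        (E := fun y : N ↦ TangentSpace (𝓡 m) y →L[ℝ] TangentSpace (𝓡 m) y) y (D Z y)) p := by
  obtain ⟨χ, -, hχ⟩ := (SmoothBumpFunction.nhds_basis_tsupport (I := 𝓡 m) p).mem_iff.1
    (hU.mem_nhds hp)
  have h1 := ContMDiffOn.smul_section_of_tsupport (χ.contMDiff.contMDiffOn) hU hχ hZ
  have h2 := hD.contMDiff.contMDiff (σ := (χ : N → ℝ) • Z) (by simpa using h1.contMDiffOn)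
  have h3 := h2.contMDiffAt (x := p) Filter.univ_mem
  refine h3.congr_of_eventuallyEq ?_
  filter_upwards [χ.eventuallyEq_one.eventually_nhds, hU.mem_nhds hp] with y hy hyU
  -- The bump function is identically one near `y`, and a covariant derivative depends only on the
  -- germ of the field.
  have h4 : D Z y = D ((χ : N → ℝ) • Z) y := by
    refine D.isCovariantDerivativeOn.congr_of_eventuallyEq
      ((hZ.contMDiffAt (hU.mem_nhds hyU)).mdifferentiableAt (by simp))
      ((h1 y).mdifferentiableAt (by simp)) Filter.univ_mem ?_
    filter_upwards [hy] with z hz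
    simp [hz]
  rw [h4]

theorem contMDiffAt_christoffel [T2Space N] {D : Connection m N}
    (hD : D.ContMDiffCovariantDerivative ∞) {q p : N}
    (hp : p ∈ (chartAt (EuclideanSpace ℝ (Fin m)) q).source) :
    ContMDiffAt (𝓡 m) 𝓘(ℝ, EuclideanSpace ℝ (Fin m) →L[ℝ]
      EuclideanSpace ℝ (Fin m) →L[ℝ] EuclideanSpace ℝ (Fin m)) ∞ (christoffel D q) p := by
  refine contMDiffAt_clm_of_apply fun b ↦ contMDiffAt_clm_of_apply fun a ↦ ?_
  have h1 := contMDiffAt_cov hD (chartAt (EuclideanSpace ℝ (Fin m)) q).open_source hp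
    (Z := fun z ↦ coordSymm q z b)
    fun y hy ↦ (contMDiffAt_coordSymm ∞ le_rfl hy b).contMDiffWithinAt
  have h2 := h1.clm_bundle_apply (contMDiffAt_coordSymm ∞ le_rfl hp a)
  have h3 := ((smoothAlongAt_iff (f := fun p : N ↦ p) hp).1 h2).2
  refine h3.congr_of_eventuallyEq ?_
  filter_upwards [(chartAt (EuclideanSpace ℝ (Fin m)) q).open_source.mem_nhds hp] with y hy
  exact christoffel_apply D hy b a

end Christoffel

/-! ### The pulled back connection -/

section CovAlong

variable {n m : ℕ}
  {M : Type*} [TopologicalSpace M] [ChartedSpace (EuclideanSpace ℝ (Fin n)) M]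
  {N : Type*} [TopologicalSpace N] [ChartedSpace (EuclideanSpace ℝ (Fin m)) N]
  [IsManifold (𝓡 m) ∞ N]
  {D : Connection m N} {f : M → N} {W : Π x : M, TangentSpace (𝓡 m) (f x)} {x : M} {q : N}

theorem covAlong_eq (D : Connection m N) (hf : ContinuousAt f x)
    (W : Π x : M, TangentSpace (𝓡 m) (f x)) (u : TangentSpace (𝓡 n) x) :
    covAlong D f W x u = coordSymm (n := m) (f x) (f x)
        (mvfderiv (𝓡 n) (fun y ↦ coord (n := m) (f x) (f y) (W y)) x u)
      + D (fun q ↦ coordSymm (f x) q (coord (f x) (f x) (W x))) (f x)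
        (mfderiv (𝓡 n) (𝓡 m) f x u) := by
  have h1 := mvfderiv_congr (n := n) (x := x)
    (coord_along_eventuallyEq hf (mem_chart_source (EuclideanSpace ℝ (Fin m)) (f x)) W)
  have h2 : (trivializationAt (EuclideanSpace ℝ (Fin m)) (TangentSpace (𝓡 m) : N → Type _) (f x)
      (TotalSpace.mk' (EuclideanSpace ℝ (Fin m)) (f x) (W x))).2 = coord (f x) (f x) (W x) :=
    (coord_eq (mem_chart_source (EuclideanSpace ℝ (Fin m)) (f x)) _).symm
  have h3 (b : EuclideanSpace ℝ (Fin m)) : D (fun q ↦ (trivializationAt (EuclideanSpace ℝ (Fin m))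
      (TangentSpace (𝓡 m) : N → Type _) (f x)).symm q b) (f x)
        = D (fun q ↦ coordSymm (f x) q b) (f x) := by
    have h4 := diffAt_coordSymm (mem_chart_source (EuclideanSpace ℝ (Fin m)) (f x)) b
    have h5 : ∀ᶠ q in 𝓝 (f x), (trivializationAt (EuclideanSpace ℝ (Fin m))
        (TangentSpace (𝓡 m) : N → Type _) (f x)).symm q b = coordSymm (f x) q b := by
      filter_upwards [eventually_mem_source m (f x)] with q hq
      exact trivializationAt_symm_eq hq _
    refine D.isCovariantDerivativeOn.congr_of_eventuallyEq ?_ h4 Filter.univ_mem h5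
    refine h4.congr_of_eventuallyEq ?_
    filter_upwards [h5] with q hq
    rw [hq]
  unfold covAlong
  simp only [h2, h3, h1]
  rw [trivializationAt_symm_eq (mem_chart_source _ (f x))]

theorem coord_covAlong_self (D : Connection m N) (hf : ContinuousAt f x)
    (W : Π x : M, TangentSpace (𝓡 m) (f x)) (u : TangentSpace (𝓡 n) x) :
    coord (f x) (f x) (covAlong D f W x u)
      = mvfderiv (𝓡 n) (fun y ↦ coord (f x) (f y) (W y)) x u
        + christoffel D (f x) (f x) (coord (f x) (f x) (W x))
          (coord (f x) (f x) (mfderiv (𝓡 n) (𝓡 m) f x u)) := by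
  rw [covAlong_eq D hf, map_add, christoffel_apply D (mem_chart_source _ _),
    coordSymm_coord (mem_chart_source _ _), coord_coordSymm (mem_chart_source _ _)]

theorem differentiableAt_coordChange (q p : N) {p' : N}
    (hq : p' ∈ (chartAt (EuclideanSpace ℝ (Fin m)) q).source)
    (hp : p' ∈ (chartAt (EuclideanSpace ℝ (Fin m)) p).source) :
    MDifferentiableAt (𝓡 m) 𝓘(ℝ, EuclideanSpace ℝ (Fin m) →L[ℝ] EuclideanSpace ℝ (Fin m))
      (fun z ↦ (coord (n := m) q z).comp (coordSymm (n := m) p z)) p' := by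
  refine ContMDiffAt.mdifferentiableAt (n := ∞) (contMDiffAt_clm_of_apply fun b ↦ ?_) (by simp)
  exact ((smoothAlongAt_iff (f := fun p : N ↦ p) hq).1 (contMDiffAt_coordSymm ∞ le_rfl hp b)).2

/-- The derivative of a vector field along a map, in an arbitrary preferred chart. -/
theorem coord_covAlong (D : Connection m N)
    (hx : f x ∈ (chartAt (EuclideanSpace ℝ (Fin m)) q).source) (hW : DiffAlongAt n f W x)
    (u : TangentSpace (𝓡 n) x) :
    coord q (f x) (covAlong D f W x u) = mvfderiv (𝓡 n) (fun y ↦ coord q (f y) (W y)) x u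
      + christoffel D q (f x) (coord q (f x) (W x))
        (coord q (f x) (mfderiv (𝓡 n) (𝓡 m) f x u)) := by
  have hs := mem_chart_source (EuclideanSpace ℝ (Fin m)) (f x)
  obtain ⟨hf, hW'⟩ := (diffAlongAt_iff hs).1 hW
  have hA := differentiableAt_coordChange q (f x) hx hs
  have h1 : (fun y ↦ coord (n := m) q (f y) (W y)) =ᶠ[𝓝 x] fun y ↦
      ((coord (n := m) q (f y)).comp (coordSymm (n := m) (f x) (f y)))
        (coord (n := m) (f x) (f y) (W y)) := by
    filter_upwards [hf.continuousAt (eventually_mem_source m (f x))] with y hy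
    rw [ContinuousLinearMap.comp_apply, coordSymm_coord hy]
  have hA' : MDifferentiableAt (𝓡 n)
      𝓘(ℝ, EuclideanSpace ℝ (Fin m) →L[ℝ] EuclideanSpace ℝ (Fin m))
      (fun y ↦ (coord (n := m) q (f y)).comp (coordSymm (n := m) (f x) (f y))) x := hA.comp x hf
  -- `covAlong` uses a chart that moves with the point, whereas iterated derivatives need a fixed
  -- one. Applied to fields that are constant in the chart at `f x`, the formula `∇ = d + Γ` in the
  -- chart at `q` is the transformation law of Christoffel symbols; its inhomogeneous term is the
  -- derivative of the transition map, which the product rule produces for `W`.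
  have h2 (b : EuclideanSpace ℝ (Fin m)) := coord_cov D hx (diffAt_coordSymm hs b)
    (mfderiv (𝓡 n) (𝓡 m) f x u)
  have h3 (b : EuclideanSpace ℝ (Fin m)) :
      mvfderiv (𝓡 m) (fun y ↦ coord (n := m) q y (coordSymm (n := m) (f x) y b)) (f x)
        (mfderiv (𝓡 n) (𝓡 m) f x u)
      = mvfderiv (𝓡 n) (fun y ↦ (coord (n := m) q (f y)).comp
          (coordSymm (n := m) (f x) (f y))) x u b := by
    rw [mvfderiv_comp_map hA hf]
    have := mvfderiv_clm_apply hA (w := fun _ ↦ b) mdifferentiableAt_const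
      (mfderiv (𝓡 n) (𝓡 m) f x u)
    rw [mvfderiv_const] at this
    simpa using this
  rw [covAlong_eq D hf.continuousAt, map_add, h2, coordSymm_coord hs, h3,
    mvfderiv_congr h1, mvfderiv_clm_apply hA' hW' u, ← add_assoc]
  congr 1
  exact add_comm _ _

theorem coord_ext_of_eq {x y : N} {X Y : TangentSpace (𝓡 m) y}
    (hy : y ∈ (chartAt (EuclideanSpace ℝ (Fin m)) x).source) (h : coord x y X = coord x y Y) :
    X = Y := by
  rw [← coordSymm_coord hy X, h, coordSymm_coord hy]

theorem covAlong_congr (hf : ContinuousAt f x) {W' : Π x : M, TangentSpace (𝓡 m) (f x)}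
    (h : ∀ᶠ y in 𝓝 x, W y = W' y) (u : TangentSpace (𝓡 n) x) :
    covAlong D f W x u = covAlong D f W' x u := by
  have h1 : (fun y ↦ coord (f x) (f y) (W y)) =ᶠ[𝓝 x] fun y ↦ coord (f x) (f y) (W' y) := by
    filter_upwards [h] with y hy
    rw [hy]
  rw [covAlong_eq D hf, covAlong_eq D hf, mvfderiv_congr h1, h.self_of_nhds]

theorem covAlong_add {W' : Π x : M, TangentSpace (𝓡 m) (f x)} (hW : DiffAlongAt n f W x)
    (hW' : DiffAlongAt n f W' x) (u : TangentSpace (𝓡 n) x) :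
    covAlong D f (fun y ↦ W y + W' y) x u = covAlong D f W x u + covAlong D f W' x u := by
  obtain ⟨hf, h1⟩ := (diffAlongAt_iff (mem_chart_source _ (f x))).1 hW
  obtain ⟨-, h2⟩ := (diffAlongAt_iff (mem_chart_source _ (f x))).1 hW'
  refine coord_ext_of_eq (mem_chart_source _ (f x)) ?_
  rw [map_add (coord (f x) (f x)) (covAlong D f W x u), coord_covAlong_self D hf.continuousAt,
    coord_covAlong_self D hf.continuousAt, coord_covAlong_self D hf.continuousAt]
  simp only [map_add]
  rw [mvfderiv_fun_add h1 h2]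
  simp only [add_apply]
  abel

theorem covAlong_smul {φ : M → ℝ} (hφ : MDifferentiableAt (𝓡 n) 𝓘(ℝ) φ x)
    (hW : DiffAlongAt n f W x) (u : TangentSpace (𝓡 n) x) :
    covAlong D f (fun y ↦ φ y • W y) x u
      = φ x • covAlong D f W x u + mvfderiv (𝓡 n) φ x u • W x := by
  obtain ⟨hf, h1⟩ := (diffAlongAt_iff (mem_chart_source _ (f x))).1 hW
  refine coord_ext_of_eq (mem_chart_source _ (f x)) ?_
  rw [map_add (coord (f x) (f x)) (φ x • covAlong D f W x u), map_smul (coord (f x) (f x)) (φ x),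
    coord_covAlong_self D hf.continuousAt, coord_covAlong_self D hf.continuousAt]
  simp only [map_smul]
  rw [mvfderiv_fun_smul hφ h1]
  simp only [add_apply, smul_apply, ContinuousLinearMap.smulRight_apply, smul_add]
  abel

/-- `covAlong` as a continuous linear map. -/
def covAlongL (D : Connection m N) (f : M → N) (W : Π x : M, TangentSpace (𝓡 m) (f x)) (x : M) :
    TangentSpace (𝓡 n) x →L[ℝ] TangentSpace (𝓡 m) (f x) :=
  (coordSymm (f x) (f x)).comp (mvfderiv (𝓡 n) (fun y ↦ coord (f x) (f y) (W y)) x)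
    + (D (fun q ↦ coordSymm (f x) q (coord (f x) (f x) (W x))) (f x)).comp (mfderiv (𝓡 n) (𝓡 m) f x)

theorem covAlongL_apply (hf : ContinuousAt f x) (u : TangentSpace (𝓡 n) x) :
    covAlongL D f W x u = covAlong D f W x u := by
  rw [covAlong_eq D hf]
  rfl

/-- The pushforward `df(Y)`. -/
abbrev push (m : ℕ) {N : Type*} [TopologicalSpace N]
    [ChartedSpace (EuclideanSpace ℝ (Fin m)) N] (f : M → N) (Y : Π x : M, TangentSpace (𝓡 n) x)
    (x : M) : TangentSpace (𝓡 m) (f x) :=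
  mfderiv (𝓡 n) (𝓡 m) f x (Y x)

theorem smoothAlongAt_push [IsManifold (𝓡 n) ∞ M] (hf : ContMDiff (𝓡 n) (𝓡 m) ∞ f)
    {Y : Π x : M, TangentSpace (𝓡 n) x}
    (hY : SmoothAlongAt n (fun x : M ↦ x) Y x) : SmoothAlongAt n f (push m f Y) x :=
  (hf.contMDiff_tangentMap (m := ∞) (by norm_cast)).contMDiffAt.comp x hY

theorem diffAlongAt_push [IsManifold (𝓡 n) ∞ M] (hf : ContMDiff (𝓡 n) (𝓡 m) ∞ f)
    {Y : Π x : M, TangentSpace (𝓡 n) x}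
    (hY : DiffAt Y x) : DiffAlongAt n f (push m f Y) x :=
  ((hf.contMDiff_tangentMap (m := ∞) (by norm_cast)).mdifferentiable (by simp) _).comp x hY

theorem smoothAlongAt_covAlong [IsManifold (𝓡 n) ∞ M] [T2Space N]
    (hD : D.ContMDiffCovariantDerivative ∞)
    (hf : ContMDiff (𝓡 n) (𝓡 m) ∞ f) (hW : SmoothAlongAt n f W x)
    {V : Π x : M, TangentSpace (𝓡 n) x} (hV : SmoothAlongAt n (fun x : M ↦ x) V x) :
    SmoothAlongAt n f (fun y ↦ covAlong D f W y (V y)) x := by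
  have hs := mem_chart_source (EuclideanSpace ℝ (Fin m)) (f x)
  have hp := ((smoothAlongAt_iff hs).1 (smoothAlongAt_push hf hV)).2
  have hw := ((smoothAlongAt_iff hs).1 hW).2
  refine (smoothAlongAt_iff hs).2 ⟨hf.contMDiffAt, ?_⟩
  have h1 := contMDiffAt_mvfderiv_apply (r := ∞) hw (by norm_cast) hV
  have h2 := ((contMDiffAt_christoffel hD hs).comp x hf.contMDiffAt).clm_apply hw
  refine (h1.add (h2.clm_apply hp)).congr_of_eventuallyEq ?_
  filter_upwards [hf.continuous.continuousAt (eventually_mem_source m (f x)),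
    hW.eventually_diffAlongAt] with y hy hWy
  exact coord_covAlong D hy hWy (V y)

/-- Exhibits the coordinates of `df(V)` as first derivatives of the coordinate expression of `f`, so
that equality of mixed derivatives applies to their derivatives. -/
theorem coord_push_eventuallyEq (hf : ContMDiff (𝓡 n) (𝓡 m) ∞ f)
    (V : Π x : M, TangentSpace (𝓡 n) x) :
    (fun y ↦ coord (n := m) (f x) (f y) (push m f V y))
      =ᶠ[𝓝 x] fun y ↦ mvfderiv (𝓡 n) (fun z ↦ extChartAt (𝓡 m) (f x) (f z)) y (V y) := by
  filter_upwards [hf.continuous.continuousAt (eventually_mem_source m (f x))] with y hy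
  have h1 : coord (n := m) (f x) (f y) = _ :=
    TangentBundle.continuousLinearMapAt_trivializationAt hy
  rw [h1]
  exact (mfderiv_comp_apply y (mdifferentiableAt_extChartAt hy)
    (hf.mdifferentiable (by simp) y) (V y)).symm

omit [IsManifold (𝓡 m) ∞ N] in
theorem contMDiffAt_extChartAt_comp (hf : ContMDiff (𝓡 n) (𝓡 m) ∞ f) :
    ContMDiffAt (𝓡 n) 𝓘(ℝ, EuclideanSpace ℝ (Fin m)) ∞
      (fun z ↦ extChartAt (𝓡 m) (f x) (f z)) x :=
  contMDiffAt_extChartAt.comp x hf.contMDiffAt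

variable [IsManifold (𝓡 n) ∞ M]

theorem mvfderiv_coord_push_ext_comm (hf : ContMDiff (𝓡 n) (𝓡 m) ∞ f)
    (u v : TangentSpace (𝓡 n) x) :
    mvfderiv (𝓡 n) (fun y ↦ coord (n := m) (f x) (f y) (push m f (ext v) y)) x u
      = mvfderiv (𝓡 n) (fun y ↦ coord (n := m) (f x) (f y) (push m f (ext u) y)) x v := by
  rw [mvfderiv_congr (coord_push_eventuallyEq hf _), mvfderiv_congr (coord_push_eventuallyEq hf _)]
  exact mvfderiv_mvfderiv_ext_comm ((contMDiffAt_extChartAt_comp hf).of_le (by norm_cast)) u v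

/-- Fields with constant coordinates commute, so the torsion is the skew part of `Γ`. -/
theorem christoffel_symm (hD : D.torsion = 0) (q : N) (a b : EuclideanSpace ℝ (Fin m)) :
    christoffel D q q a b = christoffel D q q b a := by
  have h : ∀ a : EuclideanSpace ℝ (Fin m), DiffAt (fun z : N ↦ coordSymm q z a) q :=
    diffAt_coordSymm (mem_chart_source _ q)
  have h1 := (CovariantDerivative.torsion_eq_zero_iff (cov := D)).1 hD (h b) (h a)
  have h2 : VectorField.mlieBracket (𝓡 m) (fun z ↦ coordSymm q z b) (fun z ↦ coordSymm q z a) q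
      = 0 := by
    rw [← mlieBracket_ext_ext (x := q) b a]
    refine Filter.EventuallyEq.mlieBracket_vectorField_eq ?_ ?_
    · filter_upwards [ext_eventuallyEq (x := q) b] with z hz using hz.symm
    · filter_upwards [ext_eventuallyEq (x := q) a] with z hz using hz.symm
  rw [h2, sub_eq_zero] at h1
  rw [christoffel_apply D (mem_chart_source _ q), christoffel_apply D (mem_chart_source _ q), h1]

/-- The pulled back connection of a torsion-free connection is symmetric. -/
theorem covAlong_push_ext_comm (hD : D.torsion = 0) (hf : ContMDiff (𝓡 n) (𝓡 m) ∞ f)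
    (u v : TangentSpace (𝓡 n) x) :
    covAlong D f (push m f (ext v)) x u = covAlong D f (push m f (ext u)) x v := by
  have hc := hf.continuous.continuousAt (x := x)
  refine coord_ext_of_eq (mem_chart_source _ (f x)) ?_
  rw [coord_covAlong_self D hc, coord_covAlong_self D hc, mvfderiv_coord_push_ext_comm hf,
    christoffel_symm hD]
  simp only [push, ext_self]

end CovAlong

/-! ### The curvature along a map -/

section CurvatureAlong

variable {n m : ℕ}
  {M : Type*} [TopologicalSpace M] [ChartedSpace (EuclideanSpace ℝ (Fin n)) M]
  [IsManifold (𝓡 n) ∞ M]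
  {N : Type*} [TopologicalSpace N] [T2Space N] [ChartedSpace (EuclideanSpace ℝ (Fin m)) N]
  [IsManifold (𝓡 m) ∞ N]
  {D : Connection m N} {f : M → N} {W : Π x : M, TangentSpace (𝓡 m) (f x)} {x : M}

theorem coord_covAlong_covAlong (hD : D.ContMDiffCovariantDerivative ∞)
    (hf : ContMDiff (𝓡 n) (𝓡 m) ∞ f) (hW : SmoothAlongAt n f W x)
    (u v : TangentSpace (𝓡 n) x) :
    coord (f x) (f x) (covAlong D f (fun y ↦ covAlong D f W y (ext v y)) x u)
      = mvfderiv (𝓡 n) (fun y ↦ mvfderiv (𝓡 n)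
            (fun y ↦ coord (n := m) (f x) (f y) (W y)) y (ext v y)) x u
        + (mvfderiv (𝓡 m) (christoffel D (f x)) (f x) (mfderiv (𝓡 n) (𝓡 m) f x u)
              (coord (f x) (f x) (W x)) (coord (f x) (f x) (mfderiv (𝓡 n) (𝓡 m) f x v))
          + christoffel D (f x) (f x)
              (mvfderiv (𝓡 n) (fun y ↦ coord (n := m) (f x) (f y) (W y)) x u)
              (coord (f x) (f x) (mfderiv (𝓡 n) (𝓡 m) f x v))
          + christoffel D (f x) (f x) (coord (f x) (f x) (W x))
              (mvfderiv (𝓡 n) (fun y ↦ coord (n := m) (f x) (f y) (push m f (ext v) y)) x u))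
        + christoffel D (f x) (f x)
            (mvfderiv (𝓡 n) (fun y ↦ coord (n := m) (f x) (f y) (W y)) x v
              + christoffel D (f x) (f x) (coord (f x) (f x) (W x))
                (coord (f x) (f x) (mfderiv (𝓡 n) (𝓡 m) f x v)))
            (coord (f x) (f x) (mfderiv (𝓡 n) (𝓡 m) f x u)) := by
  have hs := mem_chart_source (EuclideanSpace ℝ (Fin m)) (f x)
  have hc := hf.continuous.continuousAt (x := x)
  have hf' : MDifferentiableAt (𝓡 n) (𝓡 m) f x := hf.mdifferentiable (by simp) x
  have hv := contMDiffAt_ext ∞ le_rfl v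
  have hw := ((smoothAlongAt_iff hs).1 hW).2
  have hF := ((smoothAlongAt_iff hs).1 (smoothAlongAt_push hf hv)).2
  have hΓ := contMDiffAt_christoffel hD hs
  have hΓf := hΓ.comp x hf.contMDiffAt
  have hev : (fun y ↦ coord (n := m) (f x) (f y) (covAlong D f W y (ext v y)))
      =ᶠ[𝓝 x] fun y ↦ mvfderiv (𝓡 n) (fun y ↦ coord (n := m) (f x) (f y) (W y)) y (ext v y)
        + christoffel D (f x) (f y) (coord (n := m) (f x) (f y) (W y))
          (coord (n := m) (f x) (f y) (push m f (ext v) y)) := by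
    filter_upwards [hc (eventually_mem_source m (f x)), hW.eventually_diffAlongAt] with y hy hWy
    exact coord_covAlong D hy hWy _
  have hd : MDifferentiableAt (𝓡 n) 𝓘(ℝ, EuclideanSpace ℝ (Fin m)) (fun y ↦ mvfderiv (𝓡 n)
      (fun y ↦ coord (n := m) (f x) (f y) (W y)) y (ext v y)) x :=
    (contMDiffAt_mvfderiv_apply (r := ∞) hw (by norm_cast) hv).mdifferentiableAt (by simp)
  have hΓd : MDifferentiableAt (𝓡 n) 𝓘(ℝ, EuclideanSpace ℝ (Fin m) →L[ℝ]
      EuclideanSpace ℝ (Fin m) →L[ℝ] EuclideanSpace ℝ (Fin m))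
      (fun y ↦ christoffel D (f x) (f y)) x := hΓf.mdifferentiableAt (by simp)
  have hΓw : MDifferentiableAt (𝓡 n) 𝓘(ℝ, EuclideanSpace ℝ (Fin m) →L[ℝ]
      EuclideanSpace ℝ (Fin m))
      (fun y ↦ christoffel D (f x) (f y) (coord (n := m) (f x) (f y) (W y))) x :=
    (hΓf.clm_apply hw).mdifferentiableAt (by simp)
  have hwd : MDifferentiableAt (𝓡 n) 𝓘(ℝ, EuclideanSpace ℝ (Fin m))
      (fun y ↦ coord (n := m) (f x) (f y) (W y)) x := hw.mdifferentiableAt (by simp)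
  have hFd : MDifferentiableAt (𝓡 n) 𝓘(ℝ, EuclideanSpace ℝ (Fin m))
      (fun y ↦ coord (n := m) (f x) (f y) (push m f (ext v) y)) x :=
    hF.mdifferentiableAt (by simp)
  have hΓF : MDifferentiableAt (𝓡 n) 𝓘(ℝ, EuclideanSpace ℝ (Fin m))
      (fun y ↦ christoffel D (f x) (f y) (coord (n := m) (f x) (f y) (W y))
        (coord (n := m) (f x) (f y) (push m f (ext v) y))) x :=
    ((hΓf.clm_apply hw).clm_apply hF).mdifferentiableAt (by simp)
  rw [coord_covAlong_self D hc, mvfderiv_congr hev, mvfderiv_fun_add hd hΓF, add_apply,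
    mvfderiv_clm_apply hΓw hFd, mvfderiv_clm_apply hΓd hwd,
    mvfderiv_comp_map (hΓ.mdifferentiableAt (by simp)) hf', coord_covAlong_self D hc W]
  simp only [push, ext_self, add_apply]

/-- The components of the curvature in terms of the Christoffel symbols. -/
def curvatureCoord (D : Connection m N) (q : N) (X Y : TangentSpace (𝓡 m) q)
    (c : EuclideanSpace ℝ (Fin m)) : EuclideanSpace ℝ (Fin m) :=
  mvfderiv (𝓡 m) (christoffel D q) q X c (coord q q Y)
    - mvfderiv (𝓡 m) (christoffel D q) q Y c (coord q q X)
    + christoffel D q q (christoffel D q q c (coord q q Y)) (coord q q X)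
    - christoffel D q q (christoffel D q q c (coord q q X)) (coord q q Y)

/-- The second derivatives of `W` and of `f` are symmetric in `u`, `v`, and the terms containing one
derivative of `W` are exchanged. What remains involves `f` only through `df u` and `df v`. -/
theorem coord_covAlong_covAlong_sub (hD : D.ContMDiffCovariantDerivative ∞)
    (hf : ContMDiff (𝓡 n) (𝓡 m) ∞ f) (hW : SmoothAlongAt n f W x)
    (u v : TangentSpace (𝓡 n) x) :
    coord (f x) (f x) (covAlong D f (fun y ↦ covAlong D f W y (ext v y)) x u)
        - coord (f x) (f x) (covAlong D f (fun y ↦ covAlong D f W y (ext u y)) x v)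
      = curvatureCoord D (f x) (mfderiv (𝓡 n) (𝓡 m) f x u) (mfderiv (𝓡 n) (𝓡 m) f x v)
          (coord (f x) (f x) (W x)) := by
  have hs := mem_chart_source (EuclideanSpace ℝ (Fin m)) (f x)
  have hw := ((smoothAlongAt_iff hs).1 hW).2
  rw [coord_covAlong_covAlong hD hf hW, coord_covAlong_covAlong hD hf hW,
    mvfderiv_mvfderiv_ext_comm (hw.of_le (by norm_cast)) u v, mvfderiv_coord_push_ext_comm hf u v,
    curvatureCoord]
  simp only [map_add, add_apply]
  abel

omit [T2Space N] in
theorem covAlong_id {Z : Π q : N, TangentSpace (𝓡 m) q} {q : N} (hZ : DiffAt Z q)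
    (X : TangentSpace (𝓡 m) q) : covAlong D (fun p : N ↦ p) Z q X = D Z q X := by
  have hs := mem_chart_source (EuclideanSpace ℝ (Fin m)) q
  refine coord_ext_of_eq hs ?_
  rw [coord_covAlong (f := fun p : N ↦ p) D hs hZ, coord_cov D hs hZ]
  have h : mfderiv (𝓡 m) (𝓡 m) (fun p : N ↦ p) q X = X := by
    rw [show (fun p : N ↦ p) = id from rfl, mfderiv_id]
    rfl
  rw [h]

/-- The case of the identity map in the preceding commutator formula; it saves a second coordinate
computation of the curvature. -/
theorem coord_curvature (hD : D.ContMDiffCovariantDerivative ∞) (q : N)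
    (X Y Z : TangentSpace (𝓡 m) q) :
    coord q q (curvature D q X Y Z) = curvatureCoord D q X Y (coord q q Z) := by
  have hZ := contMDiffAt_ext ∞ le_rfl Z
  have h := coord_covAlong_covAlong_sub (f := fun p : N ↦ p) hD contMDiff_id hZ X Y
  have hev : ∀ᶠ p in 𝓝 q, DiffAt (ext Z) p := SmoothAlongAt.eventually_diffAlongAt hZ
  have key (A B : TangentSpace (𝓡 m) q) :
      covAlong D (fun p : N ↦ p) (fun y ↦ covAlong D (fun p : N ↦ p) (ext Z) y (ext B y)) q A
        = D (fun y ↦ D (ext Z) y (ext B y)) q A := by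
    have h1 : ∀ᶠ p in 𝓝 q, covAlong D (fun p : N ↦ p) (ext Z) p (ext B p)
        = D (ext Z) p (ext B p) := by
      filter_upwards [hev] with p hp using covAlong_id hp _
    rw [covAlong_congr (f := fun p : N ↦ p) continuousAt_id h1, covAlong_id]
    refine (SmoothAlongAt.diffAlongAt (smoothAlongAt_covAlong (f := fun p : N ↦ p) hD
      contMDiff_id hZ (contMDiffAt_ext ∞ le_rfl B))).congr_of_eventuallyEq ?_
    filter_upwards [h1] with p hp
    rw [hp]
  have hid (A : TangentSpace (𝓡 m) q) : mfderiv (𝓡 m) (𝓡 m) (fun p : N ↦ p) q A = A := by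
    rw [show (fun p : N ↦ p) = id from rfl, mfderiv_id]
    rfl
  rw [key, key, hid, hid, ext_self] at h
  rw [curvature, mlieBracket_ext_ext, map_zero, sub_zero, map_sub, h]

/-- The curvature of the pulled back connection is the pulled back curvature. -/
theorem covAlong_covAlong_sub (hD : D.ContMDiffCovariantDerivative ∞)
    (hf : ContMDiff (𝓡 n) (𝓡 m) ∞ f) (hW : SmoothAlongAt n f W x)
    (u v : TangentSpace (𝓡 n) x) :
    covAlong D f (fun y ↦ covAlong D f W y (ext v y)) x u
        - covAlong D f (fun y ↦ covAlong D f W y (ext u y)) x v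
      = curvature D (f x) (mfderiv (𝓡 n) (𝓡 m) f x u) (mfderiv (𝓡 n) (𝓡 m) f x v) (W x) := by
  refine coord_ext_of_eq (mem_chart_source _ (f x)) ?_
  rw [map_sub, coord_covAlong_covAlong_sub hD hf hW, coord_curvature hD]

end CurvatureAlong

/-! ### Metrics and para-complex structures along maps -/

section MetricAlong

variable {n m : ℕ}
  {M : Type*} [TopologicalSpace M] [ChartedSpace (EuclideanSpace ℝ (Fin n)) M]
  {N : Type*} [TopologicalSpace N] [ChartedSpace (EuclideanSpace ℝ (Fin m)) N]
  [IsManifold (𝓡 m) ∞ N]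
  {D : Connection m N} {f : M → N} {W W' : Π x : M, TangentSpace (𝓡 m) (f x)} {x : M}

theorem Metric.contMDiffAt_apply (g : Metric m N) (hW : SmoothAlongAt n f W x)
    (hW' : SmoothAlongAt n f W' x) :
    ContMDiffAt (𝓡 n) 𝓘(ℝ) ∞ (fun y ↦ g.val (f y) (W y) (W' y)) x := by
  have hf : ContMDiffAt (𝓡 n) (𝓡 m) ∞ f x :=
    ((smoothAlongAt_iff (mem_chart_source _ (f x))).1 hW).1
  have hg := g.smooth.contMDiffAt.comp x hf
  have h : ContMDiffAt (𝓡 n) ((𝓡 m).prod 𝓘(ℝ)) ∞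
      (fun y ↦ TotalSpace.mk' ℝ (E := Bundle.Trivial N ℝ) (f y) (g.val (f y) (W y) (W' y))) x :=
    ContMDiffAt.clm_bundle_apply₂ (E₃ := Bundle.Trivial N ℝ) hg hW hW'
  exact (contMDiffAt_totalSpace.1 h).2

theorem ParaKahlerStructure.smoothAlongAt_J (P : ParaKahlerStructure m N)
    (hW : SmoothAlongAt n f W x) : SmoothAlongAt n f (fun y ↦ P.J (f y) (W y)) x := by
  have hf : ContMDiffAt (𝓡 n) (𝓡 m) ∞ f x :=
    ((smoothAlongAt_iff (mem_chart_source _ (f x))).1 hW).1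
  have hJ := P.smooth_J.contMDiffAt.comp x hf
  exact ContMDiffAt.clm_bundle_apply hJ hW

/-- The components of a metric in the preferred chart at `q`. -/
def Metric.comp (g : Metric m N) (q p : N) :
    EuclideanSpace ℝ (Fin m) →L[ℝ] EuclideanSpace ℝ (Fin m) →L[ℝ] ℝ :=
  (ContinuousLinearMap.precomp ℝ (coordSymm (n := m) q p)).comp
    ((g.val p).comp (coordSymm (n := m) q p))

theorem Metric.comp_apply (g : Metric m N) (q p : N) (a b : EuclideanSpace ℝ (Fin m)) :
    g.comp q p a b = g.val p (coordSymm q p a) (coordSymm q p b) := rfl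

theorem Metric.contMDiffAt_comp (g : Metric m N) {q p : N}
    (hp : p ∈ (chartAt (EuclideanSpace ℝ (Fin m)) q).source) :
    ContMDiffAt (𝓡 m)
      𝓘(ℝ, EuclideanSpace ℝ (Fin m) →L[ℝ] EuclideanSpace ℝ (Fin m) →L[ℝ] ℝ) ∞ (g.comp q) p :=
  contMDiffAt_clm_of_apply fun a ↦ contMDiffAt_clm_of_apply fun b ↦
    g.contMDiffAt_apply (f := fun p : N ↦ p) (contMDiffAt_coordSymm ∞ le_rfl hp a)
      (contMDiffAt_coordSymm ∞ le_rfl hp b)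

/-- The components of an endomorphism in the preferred chart at `q`. -/
def ParaKahlerStructure.comp (P : ParaKahlerStructure m N) (q p : N) :
    EuclideanSpace ℝ (Fin m) →L[ℝ] EuclideanSpace ℝ (Fin m) :=
  (coord (n := m) q p).comp ((P.J p).comp (coordSymm (n := m) q p))

theorem ParaKahlerStructure.contMDiffAt_comp (P : ParaKahlerStructure m N) {q p : N}
    (hp : p ∈ (chartAt (EuclideanSpace ℝ (Fin m)) q).source) :
    ContMDiffAt (𝓡 m)
      𝓘(ℝ, EuclideanSpace ℝ (Fin m) →L[ℝ] EuclideanSpace ℝ (Fin m)) ∞ (P.comp q) p :=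
  contMDiffAt_clm_of_apply fun a ↦ ((smoothAlongAt_iff (f := fun p : N ↦ p) hp).1
    (P.smoothAlongAt_J (f := fun p : N ↦ p) (contMDiffAt_coordSymm ∞ le_rfl hp a))).2

theorem coord_ext_eq {x y : N} (hy : y ∈ (chartAt (EuclideanSpace ℝ (Fin m)) x).source)
    (v : TangentSpace (𝓡 m) x) : coord x y (ext v y) = coord x x v :=
  (coord_ext hy v).trans (coord_self x v).symm

/-- The condition `∇g = 0` tested on coordinate fields, whose covariant derivatives are given by `Γ`
alone. -/
theorem Metric.mvfderiv_comp (g : Metric m N) (hD : ∀ x u v w, covDeriv₂ D g.form x u v w = 0)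
    (q : N) (X : TangentSpace (𝓡 m) q) (a b : EuclideanSpace ℝ (Fin m)) :
    mvfderiv (𝓡 m) (g.comp q) q X a b
      = g.comp q q (christoffel D q q a (coord q q X)) b
        + g.comp q q a (christoffel D q q b (coord q q X)) := by
  have hs := mem_chart_source (EuclideanSpace ℝ (Fin m)) q
  have hG : MDifferentiableAt (𝓡 m)
      𝓘(ℝ, EuclideanSpace ℝ (Fin m) →L[ℝ] EuclideanSpace ℝ (Fin m) →L[ℝ] ℝ) (g.comp q) q :=
    (g.contMDiffAt_comp hs).mdifferentiableAt (by simp)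
  have hGa : MDifferentiableAt (𝓡 m) 𝓘(ℝ, EuclideanSpace ℝ (Fin m) →L[ℝ] ℝ)
      (fun p ↦ g.comp q p a) q :=
    hG.clm_apply (mdifferentiableAt_const (c := a))
  have h1 : mvfderiv (𝓡 m) (fun p ↦ g.comp q p a b) q X = mvfderiv (𝓡 m) (g.comp q) q X a b := by
    have h2 := mvfderiv_clm_apply hGa (w := fun _ ↦ b) mdifferentiableAt_const X
    have h3 := mvfderiv_clm_apply hG (w := fun _ ↦ a) mdifferentiableAt_const X
    rw [mvfderiv_const] at h2 h3
    rw [h2, h3]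
    simp
  have h4 (v : TangentSpace (𝓡 m) q) :
      D (ext v) q X = coordSymm q q (christoffel D q q (coord q q v) (coord q q X)) := by
    refine coord_ext_of_eq hs ?_
    rw [coord_coordSymm hs, coord_cov D hs (diffAt_ext v), ext_self]
    have : (fun y ↦ coord q y (ext v y)) =ᶠ[𝓝 q] fun _ ↦ coord q q v := by
      filter_upwards [eventually_mem_source m q] with y hy using coord_ext_eq hy v
    rw [mvfderiv_congr this, mvfderiv_const, zero_apply, zero_add]
  have h5 := hD q X (coordSymm q q a) (coordSymm q q b)
  have h6 : (fun y ↦ g.form y (ext (coordSymm (n := m) q q a) y)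
      (ext (coordSymm (n := m) q q b) y)) =ᶠ[𝓝 q] fun p ↦ g.comp q p a b := by
    filter_upwards [eventually_mem_source m q] with y hy
    rw [← coordSymm_coord hy (ext (coordSymm (n := m) q q a) y),
      ← coordSymm_coord hy (ext (coordSymm (n := m) q q b) y), coord_ext_eq hy, coord_ext_eq hy,
      coord_coordSymm hs, coord_coordSymm hs]
    rfl
  rw [covDeriv₂, mvfderiv_congr h6, h1, h4, h4, coord_coordSymm hs, coord_coordSymm hs, sub_sub,
    sub_eq_zero] at h5
  exact h5

/-- The metric is parallel along maps. -/
theorem Metric.mvfderiv_apply (g : Metric m N) (hD : ∀ x u v w, covDeriv₂ D g.form x u v w = 0)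
    (hW : DiffAlongAt n f W x) (hW' : DiffAlongAt n f W' x) (u : TangentSpace (𝓡 n) x) :
    mvfderiv (𝓡 n) (fun y ↦ g.val (f y) (W y) (W' y)) x u
      = g.val (f x) (covAlong D f W x u) (W' x) + g.val (f x) (W x) (covAlong D f W' x u) := by
  have hs := mem_chart_source (EuclideanSpace ℝ (Fin m)) (f x)
  obtain ⟨hf, hw⟩ := (diffAlongAt_iff hs).1 hW
  obtain ⟨-, hw'⟩ := (diffAlongAt_iff hs).1 hW'
  have h1 : (fun y ↦ g.val (f y) (W y) (W' y)) =ᶠ[𝓝 x] fun y ↦ g.comp (f x) (f y)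
      (coord (n := m) (f x) (f y) (W y)) (coord (n := m) (f x) (f y) (W' y)) := by
    filter_upwards [hf.continuousAt (eventually_mem_source m (f x))] with y hy
    rw [Metric.comp_apply, coordSymm_coord hy, coordSymm_coord hy]
  have hG : MDifferentiableAt (𝓡 m)
      𝓘(ℝ, EuclideanSpace ℝ (Fin m) →L[ℝ] EuclideanSpace ℝ (Fin m) →L[ℝ] ℝ)
      (g.comp (f x)) (f x) :=
    (g.contMDiffAt_comp hs).mdifferentiableAt (by simp)
  have hG' : MDifferentiableAt (𝓡 n)
      𝓘(ℝ, EuclideanSpace ℝ (Fin m) →L[ℝ] EuclideanSpace ℝ (Fin m) →L[ℝ] ℝ)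
      (fun y ↦ g.comp (f x) (f y)) x := hG.comp x hf
  have key (A B : TangentSpace (𝓡 m) (f x)) : g.val (f x) A B
      = g.comp (f x) (f x) (coord (f x) (f x) A) (coord (f x) (f x) B) := by
    rw [Metric.comp_apply, coordSymm_coord hs, coordSymm_coord hs]
  rw [mvfderiv_congr h1, mvfderiv_clm_apply (hG'.clm_apply hw) hw', mvfderiv_clm_apply hG' hw,
    mvfderiv_comp_map hG hf, add_apply, g.mvfderiv_comp hD, key, key (W x),
    coord_covAlong_self D hf.continuousAt, coord_covAlong_self D hf.continuousAt]
  simp only [map_add, add_apply]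
  abel

/-- The para-complex structure is parallel along maps. -/
theorem ParaKahlerStructure.covAlong_J (P : ParaKahlerStructure m N) (hW : DiffAlongAt n f W x)
    (u : TangentSpace (𝓡 n) x) :
    covAlong P.cov f (fun y ↦ P.J (f y) (W y)) x u = P.J (f x) (covAlong P.cov f W x u) := by
  have hs := mem_chart_source (EuclideanSpace ℝ (Fin m)) (f x)
  obtain ⟨hf, hw⟩ := (diffAlongAt_iff hs).1 hW
  have hJ : MDifferentiableAt (𝓡 m)
      𝓘(ℝ, EuclideanSpace ℝ (Fin m) →L[ℝ] EuclideanSpace ℝ (Fin m)) (P.comp (f x)) (f x) :=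
    (P.contMDiffAt_comp hs).mdifferentiableAt (by simp)
  have hJ' : MDifferentiableAt (𝓡 n)
      𝓘(ℝ, EuclideanSpace ℝ (Fin m) →L[ℝ] EuclideanSpace ℝ (Fin m))
      (fun y ↦ P.comp (f x) (f y)) x := hJ.comp x hf
  have h1 : (fun y ↦ coord (n := m) (f x) (f y) (P.J (f y) (W y))) =ᶠ[𝓝 x] fun y ↦
      P.comp (f x) (f y) (coord (n := m) (f x) (f y) (W y)) := by
    filter_upwards [hf.continuousAt (eventually_mem_source m (f x))] with y hy
    simp only [ParaKahlerStructure.comp, ContinuousLinearMap.comp_apply, coordSymm_coord hy]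
  have key (A : TangentSpace (𝓡 m) (f x)) : coord (f x) (f x) (P.J (f x) A)
      = P.comp (f x) (f x) (coord (f x) (f x) A) := by
    simp only [ParaKahlerStructure.comp, ContinuousLinearMap.comp_apply, coordSymm_coord hs]
  -- The condition `∇J = 0` in coordinates, `dJ + [Γ, J] = 0`, obtained from fields with constant
  -- coordinates.
  have h2 (b : EuclideanSpace ℝ (Fin m)) (X : TangentSpace (𝓡 m) (f x)) :
      mvfderiv (𝓡 m) (P.comp (f x)) (f x) X b
        + christoffel P.cov (f x) (f x) (P.comp (f x) (f x) b) (coord (f x) (f x) X)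
      = P.comp (f x) (f x) (christoffel P.cov (f x) (f x) b (coord (f x) (f x) X)) := by
    have hb := contMDiffAt_coordSymm ∞ le_rfl hs b
    have h3 := P.parallel (f x) (fun y ↦ coordSymm (f x) y b) (diffAt_coordSymm hs b) X
    have h4 : DiffAt (fun y ↦ P.J y (coordSymm (f x) y b)) (f x) :=
      (P.smoothAlongAt_J (f := fun p : N ↦ p) hb).mdifferentiableAt (by simp)
    have h5 := congrArg (coord (f x) (f x)) h3
    rw [coord_cov P.cov hs h4, key, key, coord_coordSymm hs, christoffel_apply P.cov hs,
      coordSymm_coord hs] at h5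
    have h6 := mvfderiv_clm_apply hJ (w := fun _ ↦ b) mdifferentiableAt_const X
    rw [mvfderiv_const] at h6
    rw [christoffel_apply P.cov hs b, coordSymm_coord hs, ← h5, christoffel_apply P.cov hs,
      coordSymm_coord hs]
    congr 1
    refine Eq.trans ?_ h6.symm
    simp
  refine coord_ext_of_eq hs ?_
  rw [coord_covAlong_self P.cov hf.continuousAt, key, key, mvfderiv_congr h1,
    mvfderiv_clm_apply hJ' hw, mvfderiv_comp_map hJ hf, coord_covAlong_self P.cov hf.continuousAt,
    map_add, ← h2]
  abel

end MetricAlong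

/-! ### Smoothness of sections of bundles of linear maps -/

section HomBundle

variable {n : ℕ} {M : Type*} [TopologicalSpace M] [ChartedSpace (EuclideanSpace ℝ (Fin n)) M]
  [IsManifold (𝓡 n) ∞ M]

theorem contMDiffAt_hom_of_apply {F : Type*} [NormedAddCommGroup F] [NormedSpace ℝ F]
    {E : M → Type*} [TopologicalSpace (TotalSpace F E)] [∀ x, AddCommGroup (E x)]
    [∀ x, Module ℝ (E x)] [∀ x, TopologicalSpace (E x)] [∀ x, IsTopologicalAddGroup (E x)]
    [∀ x, ContinuousSMul ℝ (E x)] [FiberBundle F E] [VectorBundle ℝ F E]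
    [ContMDiffVectorBundle ∞ F E (𝓡 n)] {φ : Π x : M, TangentSpace (𝓡 n) x →L[ℝ] E x} {x : M}
    (h : ∀ a : EuclideanSpace ℝ (Fin n), ContMDiffAt (𝓡 n) ((𝓡 n).prod 𝓘(ℝ, F)) ∞
      (fun y ↦ TotalSpace.mk' F y (φ y (coordSymm x y a))) x) :
    ContMDiffAt (𝓡 n) ((𝓡 n).prod 𝓘(ℝ, EuclideanSpace ℝ (Fin n) →L[ℝ] F)) ∞
      (fun y ↦ TotalSpace.mk' (EuclideanSpace ℝ (Fin n) →L[ℝ] F)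
        (E := fun y ↦ TangentSpace (𝓡 n) y →L[ℝ] E y) y (φ y)) x := by
  refine (contMDiffAt_hom_bundle _).2 ⟨contMDiffAt_id, contMDiffAt_clm_of_apply fun a ↦ ?_⟩
  refine ((contMDiffAt_section _).1 (h a)).congr_of_eventuallyEq ?_
  filter_upwards [(trivializationAt F E x).open_baseSet.mem_nhds
    (FiberBundle.mem_baseSet_trivializationAt' x)] with y hy
  exact Trivialization.continuousLinearMapAt_apply_of_mem (R := ℝ) _ hy _

end HomBundle

/-! ### Musical isomorphisms -/

section Sharp

variable {m : ℕ} {N : Type*} [TopologicalSpace N] [ChartedSpace (EuclideanSpace ℝ (Fin m)) N]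
  [IsManifold (𝓡 m) ∞ N]

/-- Non-degeneracy gives injectivity, and a space and its dual have equal dimension. Hence
`ContinuousLinearMap.inverse` is here a true inverse, near which inversion is smooth. -/
theorem Metric.exists_comp_eq (g : Metric m N) {q p : N}
    (hp : p ∈ (chartAt (EuclideanSpace ℝ (Fin m)) q).source) :
    ∃ e : EuclideanSpace ℝ (Fin m) ≃L[ℝ] (EuclideanSpace ℝ (Fin m) →L[ℝ] ℝ),
      (e : EuclideanSpace ℝ (Fin m) →L[ℝ] EuclideanSpace ℝ (Fin m) →L[ℝ] ℝ) = g.comp q p := by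
  have hinj : Function.Injective (g.comp q p) := by
    rw [injective_iff_map_eq_zero]
    intro a ha
    have h1 : coordSymm q p a = 0 := by
      refine g.nondegenerate p _ fun v ↦ ?_
      have := DFunLike.congr_fun ha (coord q p v)
      rwa [Metric.comp_apply, coordSymm_coord hp] at this
    rw [← coord_coordSymm hp a, h1, map_zero]
  have hdim : Module.finrank ℝ (EuclideanSpace ℝ (Fin m))
      = Module.finrank ℝ (EuclideanSpace ℝ (Fin m) →L[ℝ] ℝ) := by
    rw [← LinearMap.toContinuousLinearMap.finrank_eq]
    exact (Subspace.dual_finrank_eq).symm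
  refine ⟨(LinearMap.linearEquivOfInjective (g.comp q p).toLinearMap hinj
    hdim).toContinuousLinearEquiv, ?_⟩
  ext a b
  rfl

/-- The vector corresponding to a covector, which is given in coordinates. -/
def Metric.sharp (g : Metric m N) (q : N) :
    (EuclideanSpace ℝ (Fin m) →L[ℝ] ℝ) →L[ℝ] TangentSpace (𝓡 m) q :=
  (coordSymm (n := m) q q).comp (g.comp q q).inverse

theorem Metric.val_sharp (g : Metric m N) (q : N) (l : EuclideanSpace ℝ (Fin m) →L[ℝ] ℝ)
    (v : TangentSpace (𝓡 m) q) : g.val q (g.sharp q l) v = l (coord q q v) := by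
  have hs := mem_chart_source (EuclideanSpace ℝ (Fin m)) q
  obtain ⟨e, he⟩ := g.exists_comp_eq hs
  have h1 : g.comp q q ((g.comp q q).inverse l) = l := by
    rw [← he, ContinuousLinearMap.inverse_equiv]
    exact e.apply_symm_apply l
  conv_rhs => rw [← h1, Metric.comp_apply, coordSymm_coord hs]
  rfl

theorem Metric.eq_of_forall_val_eq (g : Metric m N) {q : N} {v w : TangentSpace (𝓡 m) q}
    (h : ∀ u, g.val q v u = g.val q w u) : v = w := by
  rw [← sub_eq_zero]
  refine g.nondegenerate q _ fun u ↦ ?_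
  rw [map_sub, sub_apply, h, sub_self]

/-- A vector field is smooth if its pairings with smooth vector fields are. -/
theorem Metric.contMDiffAt_of_apply (g : Metric m N) {q : N} {Z : Π q : N, TangentSpace (𝓡 m) q}
    (h : ∀ a : EuclideanSpace ℝ (Fin m),
      ContMDiffAt (𝓡 m) 𝓘(ℝ) ∞ (fun p ↦ g.val p (Z p) (coordSymm q p a)) q) :
    SmoothAlongAt m (fun p : N ↦ p) Z q := by
  have hs := mem_chart_source (EuclideanSpace ℝ (Fin m)) q
  refine (smoothAlongAt_iff (f := fun p : N ↦ p) hs).2 ⟨contMDiffAt_id, ?_⟩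
  let l (p : N) : EuclideanSpace ℝ (Fin m) →L[ℝ] ℝ :=
    (g.val p (Z p)).comp (coordSymm (n := m) q p)
  have hl : ContMDiffAt (𝓡 m) 𝓘(ℝ, EuclideanSpace ℝ (Fin m) →L[ℝ] ℝ) ∞ l q :=
    contMDiffAt_clm_of_apply h
  have hinv : ContMDiffAt (𝓡 m)
      𝓘(ℝ, (EuclideanSpace ℝ (Fin m) →L[ℝ] ℝ) →L[ℝ] EuclideanSpace ℝ (Fin m)) ∞
      (fun p ↦ (g.comp q p).inverse) q := by
    obtain ⟨e, he⟩ := g.exists_comp_eq hs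
    have h1 := contDiffAt_map_inverse (n := ∞) e
    rw [he] at h1
    exact h1.contMDiffAt.comp q (g.contMDiffAt_comp hs)
  refine (hinv.clm_apply hl).congr_of_eventuallyEq ?_
  filter_upwards [eventually_mem_source m q] with p hp
  obtain ⟨e, he⟩ := g.exists_comp_eq hp
  have h2 : g.comp q p (coord q p (Z p)) = l p := by
    ext a
    rw [Metric.comp_apply, coordSymm_coord hp]
    rfl
  rw [← h2, ← he, ContinuousLinearMap.inverse_equiv]
  exact (e.symm_apply_apply _).symm

end Sharp

/-! ### Spacelike Lagrangian immersions -/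

section Lagrangian

variable {n m : ℕ}
  {M : Type*} [TopologicalSpace M] [ChartedSpace (EuclideanSpace ℝ (Fin n)) M]
  [IsManifold (𝓡 n) ∞ M]
  {N : Type*} [TopologicalSpace N] [ChartedSpace (EuclideanSpace ℝ (Fin m)) N]
  [IsManifold (𝓡 m) ∞ N]
  {P : ParaKahlerStructure m N} {f : M → N}

variable (n) in
/-- Smooth spacelike isotropic maps. -/
structure IsSpacelikeIsotropic (P : ParaKahlerStructure m N) (f : M → N) : Prop where
  smooth : ContMDiff (𝓡 n) (𝓡 m) ∞ f
  spacelike : IsSpacelike (n := n) P.g f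
  isotropic : IsIsotropic (n := n) P f

namespace IsSpacelikeIsotropic

/-- The induced metric. -/
def metric (hf : IsSpacelikeIsotropic n P f) : Metric n M where
  val x := (ContinuousLinearMap.precomp ℝ (mfderiv (𝓡 n) (𝓡 m) f x)).comp
    ((P.g.val (f x)).comp (mfderiv (𝓡 n) (𝓡 m) f x))
  symm _ _ _ := P.g.symm _ _ _
  nondegenerate x u h := by
    by_contra hu
    exact (hf.spacelike x u hu).ne' (h u)
  smooth x := by
    refine contMDiffAt_hom_of_apply fun a ↦
      contMDiffAt_hom_of_apply (E := Bundle.Trivial M ℝ) fun b ↦ ?_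
    refine (contMDiffAt_section _).2 ?_
    have hs := mem_chart_source (EuclideanSpace ℝ (Fin n)) x
    exact P.g.contMDiffAt_apply
      (smoothAlongAt_push hf.smooth (contMDiffAt_coordSymm ∞ le_rfl hs a))
      (smoothAlongAt_push hf.smooth (contMDiffAt_coordSymm ∞ le_rfl hs b))

variable (hf : IsSpacelikeIsotropic n P f) {x : M}

theorem metric_val (u v : TangentSpace (𝓡 n) x) : hf.metric.val x u v
    = P.g.val (f x) (mfderiv (𝓡 n) (𝓡 m) f x u) (mfderiv (𝓡 n) (𝓡 m) f x v) := rfl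

theorem metric_form : hf.metric.form = inducedForm P.g f := rfl

/-- The orthogonal projection to the tangent space. -/
def proj (x : M) : TangentSpace (𝓡 m) (f x) →L[ℝ] TangentSpace (𝓡 n) x :=
  (hf.metric.sharp x).comp ((ContinuousLinearMap.precomp ℝ
    ((mfderiv (𝓡 n) (𝓡 m) f x).comp (coordSymm (n := n) x x))).comp (P.g.val (f x)))

theorem metric_proj (z : TangentSpace (𝓡 m) (f x)) (w : TangentSpace (𝓡 n) x) :
    hf.metric.val x (hf.proj x z) w = P.g.val (f x) z (mfderiv (𝓡 n) (𝓡 m) f x w) := by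
  have hs := mem_chart_source (EuclideanSpace ℝ (Fin n)) x
  refine (hf.metric.val_sharp x _ w).trans ?_
  change P.g.val (f x) z (mfderiv (𝓡 n) (𝓡 m) f x (coordSymm x x (coord x x w))) = _
  rw [coordSymm_coord hs]

theorem proj_push (u : TangentSpace (𝓡 n) x) :
    hf.proj x (mfderiv (𝓡 n) (𝓡 m) f x u) = u :=
  hf.metric.eq_of_forall_val_eq fun w ↦ hf.metric_proj _ w

/-- The isotropy condition, read as orthogonality of `J df(TM)` and `df(TM)`. -/
theorem proj_J_push (u : TangentSpace (𝓡 n) x) :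
    hf.proj x (P.J (f x) (mfderiv (𝓡 n) (𝓡 m) f x u)) = 0 :=
  hf.metric.nondegenerate x _ fun w ↦ (hf.metric_proj _ w).trans (hf.isotropic x u w)

theorem smooth_proj {Z : Π x : M, TangentSpace (𝓡 m) (f x)} (hZ : SmoothAlongAt n f Z x) :
    SmoothAlongAt n (fun x : M ↦ x) (fun y ↦ hf.proj y (Z y)) x := by
  refine hf.metric.contMDiffAt_of_apply fun a ↦ ?_
  simp only [metric_proj]
  exact P.g.contMDiffAt_apply hZ (smoothAlongAt_push hf.smooth
    (contMDiffAt_coordSymm ∞ le_rfl (mem_chart_source _ x) a))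

/-- The linear map `1 - ε J` followed by the orthogonal projection. -/
def projSub (ε : ℝ) (x : M) : TangentSpace (𝓡 m) (f x) →L[ℝ] TangentSpace (𝓡 n) x :=
  (hf.proj x).comp (ContinuousLinearMap.id ℝ _ - ε • P.J (f x))

theorem projSub_apply (ε : ℝ) (z : TangentSpace (𝓡 m) (f x)) :
    hf.projSub ε x z = hf.proj x z - ε • hf.proj x (P.J (f x) z) := by
  simp [projSub]

theorem projSub_push (ε : ℝ) (u : TangentSpace (𝓡 n) x) :
    hf.projSub ε x (mfderiv (𝓡 n) (𝓡 m) f x u) = u := by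
  rw [projSub_apply, proj_push, proj_J_push, smul_zero, sub_zero]

/-- The connections induced on a Lagrangian submanifold: for `ε = 0` this is the Levi-Civita
connection of the induced metric. -/
def conn (ε : ℝ) : Connection n M where
  toFun Y x := (hf.projSub ε x).comp (covAlongL P.cov f (push m f Y) x)
  isCovariantDerivativeOnUniv := by
    have hc (x : M) : ContinuousAt f x := hf.smooth.continuous.continuousAt
    constructor
    · intro Y Y' x hY hY' _
      ext1 u
      simp only [ContinuousLinearMap.comp_apply, add_apply, covAlongL_apply (hc x)]
      have : push m f (Y + Y') = fun y ↦ push m f Y y + push m f Y' y := by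
        funext y
        exact map_add _ _ _
      rw [this, covAlong_add (diffAlongAt_push hf.smooth hY) (diffAlongAt_push hf.smooth hY'),
        map_add]
    · intro Y φ x hY hφ _
      ext1 u
      simp only [ContinuousLinearMap.comp_apply, add_apply, smul_apply, covAlongL_apply (hc x),
        ContinuousLinearMap.smulRight_apply]
      have : push m f (φ • Y) = fun y ↦ φ y • push m f Y y := by
        funext y
        exact map_smul (mfderiv (𝓡 n) (𝓡 m) f y) (φ y) (Y y)
      rw [this, covAlong_smul hφ (diffAlongAt_push hf.smooth hY), map_add, map_smul, map_smul,
        projSub_push]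

theorem conn_apply (ε : ℝ) (Y : Π x : M, TangentSpace (𝓡 n) x) (u : TangentSpace (𝓡 n) x) :
    hf.conn ε Y x u = hf.projSub ε x (covAlong P.cov f (push m f Y) x u) := by
  rw [← covAlongL_apply hf.smooth.continuous.continuousAt]
  rfl

theorem smooth_conn [T2Space N] (ε : ℝ) {Y V : Π x : M, TangentSpace (𝓡 n) x}
    (hY : SmoothAlongAt n (fun x : M ↦ x) Y x) (hV : SmoothAlongAt n (fun x : M ↦ x) V x) :
    SmoothAlongAt n (fun x : M ↦ x) (fun y ↦ hf.conn ε Y y (V y)) x := by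
  have h1 : SmoothAlongAt n f (fun y ↦ covAlong P.cov f (push m f Y) y (V y)) x :=
    smoothAlongAt_covAlong P.isLeviCivita.1.1 hf.smooth (smoothAlongAt_push hf.smooth hY) hV
  have h2 := hf.smooth_proj h1
  have h3 := hf.smooth_proj (P.smoothAlongAt_J h1)
  simp only [conn_apply, projSub_apply]
  exact ContMDiffAt.sub_section h2 (ContMDiffAt.const_smul_section h3)

/-- For every `ε` a linear map is applied to the pulled back derivative of `df`, which is already
symmetric on commuting coordinate fields. -/
theorem isTorsionFree_conn [T2Space N] (ε : ℝ) : IsTorsionFree (hf.conn ε) := by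
  refine ⟨⟨⟨fun {Y} hY x _ ↦ ?_⟩⟩, ?_⟩
  · refine (contMDiffAt_hom_of_apply fun a ↦ ?_).contMDiffWithinAt
    exact hf.smooth_conn ε (hY.contMDiffAt Filter.univ_mem)
      (contMDiffAt_coordSymm ∞ le_rfl (mem_chart_source _ x) a)
  · ext1 x
    ext u v
    rw [CovariantDerivative.torsion_apply_eq_extend]
    change hf.conn ε (ext v) x (ext u x) - hf.conn ε (ext u) x (ext v x)
      - VectorField.mlieBracket (𝓡 n) (ext u) (ext v) x = 0
    rw [mlieBracket_ext_ext, ext_self, ext_self, conn_apply, conn_apply,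
      covAlong_push_ext_comm P.isLeviCivita.1.2 hf.smooth, sub_self, sub_zero]

end IsSpacelikeIsotropic

end Lagrangian

/-! ### Contractions -/

section Trace

variable {n : ℕ} {M : Type*} [TopologicalSpace M] [ChartedSpace (EuclideanSpace ℝ (Fin n)) M]
  {V : Type*} [AddCommGroup V] [Module ℝ V]

theorem map_metricTrace {V' : Type*} [AddCommGroup V'] [Module ℝ V'] (L : V →ₗ[ℝ] V')
    (h : Form₂ n M) (x : M) (T : TangentSpace (𝓡 n) x → TangentSpace (𝓡 n) x → V) :
    L (metricTrace h x T) = metricTrace h x fun a b ↦ L (T a b) := by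
  simp [metricTrace, map_sum]

theorem metricTrace_congr (h : Form₂ n M) (x : M)
    {T T' : TangentSpace (𝓡 n) x → TangentSpace (𝓡 n) x → V} (hT : ∀ a b, T a b = T' a b) :
    metricTrace h x T = metricTrace h x T' := by
  rw [show T = T' from funext fun a ↦ funext (hT a)]

theorem metricTrace_zero (h : Form₂ n M) (x : M) :
    metricTrace h x (fun _ _ ↦ (0 : V)) = 0 := by
  simp [metricTrace]

theorem metricTrace_add (h : Form₂ n M) (x : M)
    (T T' : TangentSpace (𝓡 n) x → TangentSpace (𝓡 n) x → V) :
    metricTrace h x (fun a b ↦ T a b + T' a b) = metricTrace h x T + metricTrace h x T' := by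
  simp [metricTrace, Finset.sum_add_distrib]

theorem metricTrace_smul (h : Form₂ n M) (x : M) (c : ℝ)
    (T : TangentSpace (𝓡 n) x → TangentSpace (𝓡 n) x → V) :
    metricTrace h x (fun a b ↦ c • T a b) = c • metricTrace h x T := by
  simp [metricTrace, Finset.smul_sum, smul_comm c]

end Trace

/-! ### The second fundamental form and the derivative of the induced metric -/

section Lagrangian

variable {n m : ℕ}
  {M : Type*} [TopologicalSpace M] [ChartedSpace (EuclideanSpace ℝ (Fin n)) M]
  [IsManifold (𝓡 n) ∞ M]
  {N : Type*} [TopologicalSpace N] [ChartedSpace (EuclideanSpace ℝ (Fin m)) N]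
  [IsManifold (𝓡 m) ∞ N]
  {P : ParaKahlerStructure m N} {f : M → N}

theorem ParaKahlerStructure.Ω_skew (P : ParaKahlerStructure m N) (q : N)
    (v w : TangentSpace (𝓡 m) q) : P.Ω q v w = - P.Ω q w v := P.skew q v w

/-- The linear form `z ↦ Ω(z, w)`. -/
def ParaKahlerStructure.ΩLeft (P : ParaKahlerStructure m N) (q : N) (w : TangentSpace (𝓡 m) q) :
    TangentSpace (𝓡 m) q →ₗ[ℝ] ℝ where
  toFun z := P.Ω q z w
  map_add' a b := by simp [ParaKahlerStructure.Ω]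
  map_smul' a b := by simp [ParaKahlerStructure.Ω]

theorem secondFundamentalForm₃_trace {x : M} (hmean : meanCurvature n P.g P.cov f x = 0)
    (u : TangentSpace (𝓡 n) x) :
    metricTrace (inducedForm P.g f) x (fun a b ↦ secondFundamentalForm₃ P f x a b u) = 0 := by
  have h := congrArg (P.ΩLeft (f x) (mfderiv (𝓡 n) (𝓡 m) f x u)) hmean
  rw [meanCurvature, map_metricTrace, map_zero] at h
  exact h

namespace IsSpacelikeIsotropic

variable (hf : IsSpacelikeIsotropic n P f) {x : M}

include hf in
-- The tangential part subtracted in the second fundamental form pairs to zero with `df w` under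
-- `Ω`, by isotropy.
theorem secondFundamentalForm₃_eq (u v w : TangentSpace (𝓡 n) x) :
    secondFundamentalForm₃ P f x u v w
      = P.Ω (f x) (covAlong P.cov f (push m f (ext v)) x u) (mfderiv (𝓡 n) (𝓡 m) f x w) := by
  change P.ΩLeft (f x) _ _ = P.ΩLeft (f x) _ _
  rw [secondFundamentalForm, map_sub, map_metricTrace, sub_eq_self,
    ← metricTrace_zero (inducedForm (n := n) P.g f) x]
  refine metricTrace_congr _ _ fun a b ↦ ?_
  rw [map_smul]
  exact (congrArg _ (hf.isotropic x b w)).trans (smul_zero _)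

include hf in
/-- The derivative of the condition that `f` is isotropic. -/
theorem Ω_covAlong_push {Y Z : Π x : M, TangentSpace (𝓡 n) x} (hY : DiffAt Y x)
    (hZ : DiffAt Z x) (hJ : DiffAlongAt n f (fun y ↦ P.J (f y) (push m f Y y)) x)
    (u : TangentSpace (𝓡 n) x) :
    P.Ω (f x) (covAlong P.cov f (push m f Y) x u) (push m f Z x)
      = P.Ω (f x) (covAlong P.cov f (push m f Z) x u) (push m f Y x) := by
  have h1 := P.g.mvfderiv_apply P.isLeviCivita.2 hJ (diffAlongAt_push hf.smooth hZ) u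
  have h2 : (fun y ↦ P.g.val (f y) (P.J (f y) (push m f Y y)) (push m f Z y)) = fun _ ↦ 0 := by
    funext y
    exact hf.isotropic y (Y y) (Z y)
  rw [h2, mvfderiv_const, P.covAlong_J (diffAlongAt_push hf.smooth hY)] at h1
  have h3 := P.Ω_skew (f x) (push m f Y x) (covAlong P.cov f (push m f Z) x u)
  have h4 : 0 = P.Ω (f x) (covAlong P.cov f (push m f Y) x u) (push m f Z x)
    + P.Ω (f x) (push m f Y x) (covAlong P.cov f (push m f Z) x u) := h1
  linarith

include hf in
theorem secondFundamentalForm₃_comm_left (u v w : TangentSpace (𝓡 n) x) :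
    secondFundamentalForm₃ P f x u v w = secondFundamentalForm₃ P f x v u w := by
  rw [hf.secondFundamentalForm₃_eq, hf.secondFundamentalForm₃_eq,
    covAlong_push_ext_comm P.isLeviCivita.1.2 hf.smooth]

include hf in
/-- Pairing with the tangential derivative of a vector field, without extending its value. -/
theorem Ω_covAlong_push_right {Y : Π x : M, TangentSpace (𝓡 n) x} (hY : DiffAt Y x)
    (u w : TangentSpace (𝓡 n) x) :
    P.Ω (f x) (covAlong P.cov f (push m f Y) x u) (mfderiv (𝓡 n) (𝓡 m) f x w)
      = secondFundamentalForm₃ P f x u w (Y x) := by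
  have h := hf.Ω_covAlong_push (diffAt_ext w) hY (P.smoothAlongAt_J
    (smoothAlongAt_push hf.smooth (contMDiffAt_ext ∞ le_rfl w))).diffAlongAt u
  rw [hf.secondFundamentalForm₃_eq]
  rw [show push m f (ext w) x = mfderiv (𝓡 n) (𝓡 m) f x w by rw [push, ext_self]] at h
  exact h.symm

include hf in
theorem secondFundamentalForm₃_comm_right (u v w : TangentSpace (𝓡 n) x) :
    secondFundamentalForm₃ P f x u v w = secondFundamentalForm₃ P f x u w v := by
  rw [hf.secondFundamentalForm₃_eq, hf.Ω_covAlong_push_right (diffAt_ext v), ext_self]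

include hf in
theorem secondFundamentalForm₃_trace' (hmean : meanCurvature n P.g P.cov f x = 0)
    (u : TangentSpace (𝓡 n) x) :
    metricTrace (inducedForm P.g f) x (secondFundamentalForm₃ P f x u) = 0 := by
  rw [← secondFundamentalForm₃_trace hmean u]
  refine metricTrace_congr _ _ fun a b ↦ ?_
  rw [hf.secondFundamentalForm₃_comm_left u, hf.secondFundamentalForm₃_comm_right a]

include hf in
theorem cubicForm_eq (hmean : meanCurvature n P.g P.cov f x = 0) (u v w : TangentSpace (𝓡 n) x) :
    cubicForm P f x u v w = secondFundamentalForm₃ P f x u v w := by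
  have h (u : TangentSpace (𝓡 n) x) : meanCurvatureForm P f x u = 0 :=
    hf.secondFundamentalForm₃_trace' hmean u
  rw [cubicForm, h, h, h]
  ring

/-- The term `-ε J` in `projSub` turns the pairing by `g` into one by `Ω`, hence into `Π`; this
identifies `conn 1` with `D - B`. -/
theorem metric_conn (ε : ℝ) {Y : Π x : M, TangentSpace (𝓡 n) x} (hY : DiffAt Y x)
    (u w : TangentSpace (𝓡 n) x) :
    hf.metric.val x (hf.conn ε Y x u) w
      = P.g.val (f x) (covAlong P.cov f (push m f Y) x u) (mfderiv (𝓡 n) (𝓡 m) f x w)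
        - ε * secondFundamentalForm₃ P f x u (Y x) w := by
  rw [conn_apply, projSub_apply, map_sub, sub_apply, map_smul, smul_apply, metric_proj,
    metric_proj, hf.secondFundamentalForm₃_comm_right, ← hf.Ω_covAlong_push_right hY]
  rfl

/-- The ambient derivatives cancel because `g` is parallel; each of the two slots of `h` contributes
`ε Π`, and these agree by symmetry. -/
theorem covDeriv₂_conn (ε : ℝ) (u v w : TangentSpace (𝓡 n) x) :
    covDeriv₂ (hf.conn ε) hf.metric.form x u v w
      = 2 * ε * secondFundamentalForm₃ P f x u v w := by
  have h1 := P.g.mvfderiv_apply P.isLeviCivita.2 (diffAlongAt_push hf.smooth (diffAt_ext v))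
    (diffAlongAt_push hf.smooth (diffAt_ext w)) u
  have h2 := hf.metric_conn ε (diffAt_ext v) u w
  have h3 := hf.metric_conn ε (diffAt_ext w) u v
  rw [hf.metric.symm] at h3
  rw [ext_self] at h2 h3
  rw [P.g.symm (f x) (push m f (ext v) x)] at h1
  simp only [push, ext_self] at h1
  rw [hf.secondFundamentalForm₃_comm_right u w v] at h3
  have h4 : covDeriv₂ (hf.conn ε) hf.metric.form x u v w
    = mvfderiv (𝓡 n) (fun y ↦ P.g.val (f y) (mfderiv (𝓡 n) (𝓡 m) f y (ext v y))
        (mfderiv (𝓡 n) (𝓡 m) f y (ext w y))) x u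
      - hf.metric.val x (hf.conn ε (ext v) x u) w
      - hf.metric.val x v (hf.conn ε (ext w) x u) := rfl
  rw [h4, h1, h2, h3]
  ring

theorem isLeviCivita_conn [T2Space N] : IsLeviCivita hf.metric (hf.conn 0) :=
  ⟨hf.isTorsionFree_conn 0, fun x u v w ↦ by rw [covDeriv₂_conn]; ring⟩

theorem isInducedConnection_conn (hmean : ∀ x, meanCurvature n P.g P.cov f x = 0) :
    IsInducedConnection P f (hf.conn 0) (hf.conn 1) := by
  intro x Y hY u w
  rw [hf.cubicForm_eq (hmean x)]
  have h0 := hf.metric_conn 0 hY u w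
  have h1 := hf.metric_conn 1 hY u w
  rw [metric_val] at h0 h1
  rw [inducedForm, inducedForm, h0, h1]
  ring

/-! ### The curvature of the induced connection -/

include hf in
/-- The tangent space of `N` is the sum of that of the Lagrangian submanifold and its image. -/
theorem exists_eq_push_add_J_push (hdim : m = 2 * n) (z : TangentSpace (𝓡 m) (f x)) :
    ∃ a b : TangentSpace (𝓡 n) x,
      z = mfderiv (𝓡 n) (𝓡 m) f x a + P.J (f x) (mfderiv (𝓡 n) (𝓡 m) f x b) := by
  have hinj (a : TangentSpace (𝓡 n) x) (ha : mfderiv (𝓡 n) (𝓡 m) f x a = 0) : a = 0 := by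
    by_contra h
    have := hf.spacelike x a h
    rw [inducedForm, ha, map_zero] at this
    exact this.false
  let L : (TangentSpace (𝓡 n) x × TangentSpace (𝓡 n) x) →ₗ[ℝ] TangentSpace (𝓡 m) (f x) :=
    ((mfderiv (𝓡 n) (𝓡 m) f x).coprod
      ((P.J (f x)).comp (mfderiv (𝓡 n) (𝓡 m) f x))).toLinearMap
  have hL (a b : TangentSpace (𝓡 n) x) : L (a, b)
    = mfderiv (𝓡 n) (𝓡 m) f x a + P.J (f x) (mfderiv (𝓡 n) (𝓡 m) f x b) := rfl
  have hLinj : Function.Injective L := by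
    rw [injective_iff_map_eq_zero]
    rintro ⟨a, b⟩ hab
    rw [hL] at hab
    have ha : a = 0 := by
      have := congrArg (hf.proj x) hab
      rwa [map_add, proj_push, proj_J_push, add_zero, map_zero] at this
    rw [ha, map_zero, zero_add] at hab
    have hb := congrArg (P.J (f x)) hab
    rw [P.J_J, map_zero] at hb
    rw [ha, hinj b hb]
    rfl
  have : FiniteDimensional ℝ (TangentSpace (𝓡 n) x) :=
    inferInstanceAs (FiniteDimensional ℝ (EuclideanSpace ℝ (Fin n)))
  have : FiniteDimensional ℝ (TangentSpace (𝓡 m) (f x)) :=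
    inferInstanceAs (FiniteDimensional ℝ (EuclideanSpace ℝ (Fin m)))
  have h1 : Module.finrank ℝ (TangentSpace (𝓡 n) x) = n := finrank_euclideanSpace_fin (𝕜 := ℝ)
  have h2 : Module.finrank ℝ (TangentSpace (𝓡 m) (f x)) = m :=
    finrank_euclideanSpace_fin (𝕜 := ℝ)
  -- Here the submanifold has to be Lagrangian, of half the dimension, and not merely isotropic.
  have hsurj := (LinearMap.injective_iff_surjective_of_finrank_eq_finrank (f := L) (by
    rw [Module.finrank_prod, h1, h2, hdim, two_mul])).1 hLinj
  obtain ⟨⟨a, b⟩, hab⟩ := hsurj z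
  exact ⟨a, b, by rw [← hab, hL]⟩

/-- If `z = df a + J df b`, then `projSub 1` sends `z` to `a - b`, while `(1 - J) z = (1 - J) df (a
- b)` since `J² = 1`. Thus `projSub 1` inverts `(1 - J) ∘ df` on the image of `1 - J`. -/
theorem push_projSub (hdim : m = 2 * n) (z : TangentSpace (𝓡 m) (f x)) :
    mfderiv (𝓡 n) (𝓡 m) f x (hf.projSub 1 x z)
      - P.J (f x) (mfderiv (𝓡 n) (𝓡 m) f x (hf.projSub 1 x z)) = z - P.J (f x) z := by
  obtain ⟨a, b, rfl⟩ := hf.exists_eq_push_add_J_push hdim z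
  have h : hf.projSub 1 x (mfderiv (𝓡 n) (𝓡 m) f x a
      + P.J (f x) (mfderiv (𝓡 n) (𝓡 m) f x b)) = a - b := by
    rw [map_add, projSub_push, projSub_apply, proj_J_push, P.J_J, proj_push]
    module
  rw [h]
  simp only [map_sub, map_add, P.J_J]
  abel

/-- As `J` is parallel, `1 - J` may be moved inside the derivative, where `push_projSub` can be
used. -/
theorem projSub_covAlong {W : Π x : M, TangentSpace (𝓡 m) (f x)} (hW : SmoothAlongAt n f W x)
    (u : TangentSpace (𝓡 n) x) :
    hf.projSub 1 x (covAlong P.cov f W x u)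
      = hf.proj x (covAlong P.cov f (fun y ↦ W y - P.J (f y) (W y)) x u) := by
  have hJ := (P.smoothAlongAt_J hW).diffAlongAt
  have h1 := covAlong_smul (D := P.cov) (φ := fun _ ↦ (-1 : ℝ)) mdifferentiableAt_const hJ u
  have h2 : DiffAlongAt n f (fun y ↦ (-1 : ℝ) • P.J (f y) (W y)) x := by
    have hs := mem_chart_source (EuclideanSpace ℝ (Fin m)) (f x)
    have h3 := (diffAlongAt_iff hs).1 hJ
    refine (diffAlongAt_iff hs).2 ⟨h3.1, ?_⟩
    simp only [map_smul]
    exact h3.2.const_smul (-1 : ℝ)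
  have h3 := covAlong_add (D := P.cov) hW.diffAlongAt h2 u
  have h4 : (fun y ↦ W y + (-1 : ℝ) • P.J (f y) (W y)) = fun y ↦ W y - P.J (f y) (W y) := by
    funext y
    module
  rw [h4, h1, P.covAlong_J hW.diffAlongAt, mvfderiv_const, zero_apply, zero_smul, add_zero] at h3
  rw [h3, projSub_apply, map_add, map_smul]
  module

theorem curvature_conn [T2Space N] (hdim : m = 2 * n) (u v w : TangentSpace (𝓡 n) x) :
    curvature (hf.conn 1) x u v w = hf.projSub 1 x (curvature P.cov (f x)
      (mfderiv (𝓡 n) (𝓡 m) f x u) (mfderiv (𝓡 n) (𝓡 m) f x v) (mfderiv (𝓡 n) (𝓡 m) f x w)) := by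
  have hw := contMDiffAt_ext ∞ le_rfl w
  have hpw := smoothAlongAt_push hf.smooth hw
  have key (a b : TangentSpace (𝓡 n) x) :
      hf.conn 1 (fun y ↦ hf.conn 1 (ext w) y (ext b y)) x a = hf.projSub 1 x
        (covAlong P.cov f (fun y ↦ covAlong P.cov f (push m f (ext w)) y (ext b y)) x a) := by
    have hb := contMDiffAt_ext ∞ le_rfl b
    -- Once `1 - J` is inside both derivatives, the inner projection to `TM` has no effect: the
    -- second derivatives for `conn 1` are projections of ambient second derivatives, with no
    -- quadratic terms in `Π`.
    rw [conn_apply, hf.projSub_covAlong (smoothAlongAt_push hf.smooth (hf.smooth_conn 1 hw hb)),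
      hf.projSub_covAlong (smoothAlongAt_covAlong P.isLeviCivita.1.1 hf.smooth hpw hb)]
    congr 2
    funext y
    rw [push, conn_apply]
    exact hf.push_projSub hdim _
  rw [curvature, mlieBracket_ext_ext, map_zero, sub_zero, key, key, ← map_sub,
    covAlong_covAlong_sub P.isLeviCivita.1.1 hf.smooth hpw, push, ext_self]

theorem curvature_conn_eq [T2Space N] (hdim : m = 2 * n) {c : ℝ} (hc : P.HasConstantCurvature c)
    (u v w : TangentSpace (𝓡 n) x) :
    curvature (hf.conn 1) x u v w
      = c • (hf.metric.val x v w • u - hf.metric.val x u w • v) := by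
  rw [hf.curvature_conn hdim, hc, hf.isotropic, hf.isotropic, hf.isotropic, mul_zero, zero_smul,
    zero_smul, zero_smul, sub_zero, sub_zero, add_zero, map_smul, map_sub, map_smul, map_smul,
    projSub_push, projSub_push]
  rfl

end IsSpacelikeIsotropic

end Lagrangian

/-! ### Conformal and projective changes -/

section Conformal

variable {n : ℕ} {M : Type*} [TopologicalSpace M] [ChartedSpace (EuclideanSpace ℝ (Fin n)) M]

theorem sum_repr_frame {x : M} {V : Type*} [AddCommGroup V] [Module ℝ V]
    (s : TangentSpace (𝓡 n) x →ₗ[ℝ] V) (u : TangentSpace (𝓡 n) x) :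
    ∑ p, (frame x).repr u p • s (frame x p) = s u := by
  conv_rhs => rw [← (frame x).sum_repr u]
  rw [map_sum]
  exact Finset.sum_congr rfl fun p _ ↦ (map_smul s _ _).symm

variable [IsManifold (𝓡 n) ∞ M] (h : Metric n M) {x : M}

theorem Metric.sum_repr (u v : TangentSpace (𝓡 n) x) :
    ∑ p, (frame x).repr u p * h.val x v (frame x p) = h.val x v u :=
  sum_repr_frame (h.val x v).toLinearMap u

theorem Metric.det_ne_zero :
    (Matrix.of fun i j ↦ h.form x (frame x i) (frame x j)).det ≠ 0 := by
  intro hdet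
  obtain ⟨v, hv, hGv⟩ := Matrix.exists_mulVec_eq_zero_iff.2 hdet
  have h1 : (frame x).equivFun.symm v = 0 := by
    refine h.nondegenerate x _ fun w ↦ ?_
    have h2 (q : Fin n) : h.val x (frame x q) ((frame x).equivFun.symm v) = 0 := by
      have h3 := congrFun hGv q
      rw [← h.sum_repr]
      simp only [Matrix.mulVec, dotProduct, Matrix.of_apply, Metric.form, Pi.zero_apply] at h3
      rw [← h3]
      refine Finset.sum_congr rfl fun p _ ↦ ?_
      rw [← Module.Basis.equivFun_apply, LinearEquiv.apply_symm_apply, mul_comm]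
    rw [← h.sum_repr]
    exact Finset.sum_eq_zero fun q _ ↦ by rw [h.symm x _ (frame x q), h2, mul_zero]
  exact hv ((LinearEquiv.map_eq_zero_iff _).1 h1)

theorem Metric.sum_inverse (u : TangentSpace (𝓡 n) x) (p : Fin n) :
    ∑ q, inverse h.form x p q * h.val x (frame x q) u = (frame x).repr u p := by
  have h1 : (fun q ↦ h.val x (frame x q) u)
      = (Matrix.of fun i j ↦ h.form x (frame x i) (frame x j)).mulVec ((frame x).repr u) := by
    funext q
    rw [← h.sum_repr]
    simp only [Matrix.mulVec, dotProduct, Matrix.of_apply, Metric.form]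
    exact Finset.sum_congr rfl fun p _ ↦ mul_comm _ _
  have h2 : (inverse h.form x).mulVec (fun q ↦ h.val x (frame x q) u) = (frame x).repr u := by
    rw [h1, inverse, Matrix.mulVec_mulVec, Matrix.nonsing_inv_mul _ h.det_ne_zero.isUnit,
      Matrix.one_mulVec]
  exact congrFun h2 p

theorem Metric.metricTrace_mul (s : TangentSpace (𝓡 n) x →L[ℝ] ℝ) (u : TangentSpace (𝓡 n) x) :
    metricTrace h.form x (fun a b ↦ s a * h.val x b u) = s u := by
  have h1 := sum_repr_frame s.toLinearMap u
  refine Eq.trans ?_ h1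
  rw [metricTrace]
  refine Finset.sum_congr rfl fun p _ ↦ ?_
  rw [← h.sum_inverse, smul_eq_mul, Finset.sum_mul]
  refine Finset.sum_congr rfl fun q _ ↦ ?_
  rw [smul_eq_mul]
  change _ * (s (frame x p) * _) = _ * s (frame x p)
  ring

theorem Metric.metricTrace_self : metricTrace h.form x (h.val x · ·) = (n : ℝ) := by
  rw [metricTrace]
  have h1 (p : Fin n) : ∑ q, inverse h.form x p q • h.val x (frame x p) (frame x q) = 1 := by
    have h2 := h.sum_inverse (frame x p) p
    rw [Module.Basis.repr_self, Finsupp.single_eq_same] at h2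
    rw [← h2]
    refine Finset.sum_congr rfl fun q _ ↦ ?_
    rw [h.symm, smul_eq_mul]
  rw [Finset.sum_congr rfl fun p _ ↦ h1 p]
  simp

theorem metricTrace_conformal {h h' : Metric n M} {φ : ℝ}
    (hφ : ∀ u v, h'.val x u v = φ * h.val x u v) {V : Type*} [AddCommGroup V] [Module ℝ V]
    (T : TangentSpace (𝓡 n) x → TangentSpace (𝓡 n) x → V) :
    metricTrace h'.form x T = φ⁻¹ • metricTrace h.form x T := by
  have h1 : inverse h'.form x = φ⁻¹ • inverse h.form x := by
    have h2 : (Matrix.of fun i j ↦ h'.form x (frame x i) (frame x j))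
        = φ • Matrix.of fun i j ↦ h.form x (frame x i) (frame x j) := by
      ext i j
      exact hφ _ _
    rw [inverse, inverse, h2]
    -- For `φ = 0` both sides are zero, as inverses of zero are zero by convention.
    rcases eq_or_ne φ 0 with rfl | h0
    · simp
    · have := Matrix.inv_smul' (Matrix.of fun i j ↦ h.form x (frame x i) (frame x j))
        (Units.mk0 φ h0) (h.det_ne_zero (x := x)).isUnit
      exact this
  simp only [metricTrace, h1, Finset.smul_sum, Matrix.smul_apply, smul_eq_mul, mul_smul]

/-- The behaviour of the covariant derivative of a metric under conformal changes of the metric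
and projective changes of the connection. -/
theorem covDeriv₂_projective_conformal {D D' : Connection n M} {h h' : Metric n M} {φ : M → ℝ}
    (hφ : ContMDiff (𝓡 n) 𝓘(ℝ) ∞ φ) (hh' : ∀ x u v, h'.val x u v = φ x * h.val x u v)
    {σ : Π x : M, TangentSpace (𝓡 n) x →L[ℝ] ℝ}
    (hD' : ∀ (x : M) (Y : Π y : M, TangentSpace (𝓡 n) y), DiffAt Y x → ∀ u : TangentSpace (𝓡 n) x,
      D' Y x u = D Y x u + σ x u • Y x + σ x (Y x) • u) (u v w : TangentSpace (𝓡 n) x) :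
    covDeriv₂ D' h'.form x u v w = mvfderiv (𝓡 n) φ x u * h.val x v w
      + φ x * (covDeriv₂ D h.form x u v w - 2 * σ x u * h.val x v w - σ x v * h.val x u w
        - σ x w * h.val x v u) := by
  have h1 : MDifferentiableAt (𝓡 n) 𝓘(ℝ) (fun y ↦ h.val y (ext v y) (ext w y)) x :=
    (h.contMDiffAt_apply (f := fun x : M ↦ x) (contMDiffAt_ext ∞ le_rfl v)
      (contMDiffAt_ext ∞ le_rfl w)).mdifferentiableAt (by simp)
  have h2 : mvfderiv (𝓡 n) (fun y ↦ h'.form y (ext v y) (ext w y)) x u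
      = φ x * mvfderiv (𝓡 n) (fun y ↦ h.form y (ext v y) (ext w y)) x u
        + mvfderiv (𝓡 n) φ x u * h.val x v w := by
    have h3 : (fun y ↦ h'.form y (ext v y) (ext w y))
        = fun y ↦ φ y • h.val y (ext v y) (ext w y) := by
      funext y
      exact hh' _ _ _
    have h4 := hφ.mdifferentiable (by simp) x
    rw [h3, mvfderiv_fun_smul h4 h1]
    simp [Metric.form]
  have h5 (a b : TangentSpace (𝓡 n) x) : h'.form x (D' (ext a) x u) b
      = φ x * (h.val x (D (ext a) x u) b + σ x u * h.val x a b + σ x a * h.val x u b) := by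
    rw [Metric.form, hh', hD' x _ (diffAt_ext a), ext_self]
    simp
  have h6 : h'.form x v (D' (ext w) x u)
      = φ x * (h.val x v (D (ext w) x u) + σ x u * h.val x v w + σ x w * h.val x v u) := by
    rw [Metric.form, hh', hD' x _ (diffAt_ext w), ext_self]
    simp
  rw [covDeriv₂, covDeriv₂, h2, h5, h6]
  simp only [Metric.form]
  ring

theorem covDeriv₂_conformal {D : Connection n M} {h h' : Metric n M} {φ : M → ℝ}
    (hφ : ContMDiff (𝓡 n) 𝓘(ℝ) ∞ φ) (hh' : ∀ x u v, h'.val x u v = φ x * h.val x u v)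
    (u v w : TangentSpace (𝓡 n) x) :
    covDeriv₂ D h'.form x u v w = mvfderiv (𝓡 n) φ x u * h.val x v w
      + φ x * covDeriv₂ D h.form x u v w := by
  rw [covDeriv₂_projective_conformal (D := D) (σ := fun _ ↦ 0) hφ hh' (by simp)]
  simp

end Conformal

/-! ### The AH structure of a Lagrangian surface -/

section Surface

variable {M : Type*} [TopologicalSpace M] [ChartedSpace (EuclideanSpace ℝ (Fin 2)) M]
  [IsManifold (𝓡 2) ∞ M]

/-- The AH structure generated by a connection and a metric for which the covariant derivative of
the metric is completely symmetric. -/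
def ahStructure (D : Connection 2 M) (hD : IsTorsionFree D) (h : Metric 2 M)
    (hDh : ∀ x u v w, covDeriv₂ D h.form x u v w = covDeriv₂ D h.form x v u w) :
    AHStructure M where
  proj := projectiveClass D
  conf := conformalClass h
  isProjective := ⟨D, hD, rfl⟩
  isConformal := ⟨h, rfl⟩
  compatible := by
    rintro D' ⟨-, σ, hσ⟩ h' ⟨φ, hφ, hpos, hh'⟩
    -- After skew-symmetrization in `u`, `v`, the conformal factor contributes `d log φ` and the
    -- projective change contributes `-2σ + σ = -σ`; the factor one half comes from the convention
    -- `2 σ_{[i} h_{j]k}`.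
    refine ⟨fun x ↦ (1 / 2 : ℝ) • ((φ x)⁻¹ • mvfderiv (𝓡 2) φ x - σ x), fun x u v w ↦ ?_⟩
    rw [covDeriv₂_projective_conformal hφ hh' hσ, covDeriv₂_projective_conformal hφ hh' hσ, hh',
      hh', hDh x v u w, h.symm x v u]
    simp only [smul_apply, sub_apply, smul_eq_mul]
    have := (hpos x).ne'
    field_simp
    ring

theorem mem_projectiveClass_self {D : Connection 2 M} (hD : IsTorsionFree D) :
    D ∈ projectiveClass D := ⟨hD, fun _ ↦ 0, by simp⟩

theorem mem_conformalClass_self (h : Metric 2 M) : h ∈ conformalClass h :=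
  ⟨fun _ ↦ 1, contMDiff_const, by simp, by simp⟩

/-- The trace of the identity is the dimension, so the coefficient is `c (2 - 1)`. -/
theorem ricci_of_curvature_eq {D : Connection 2 M} {h : Metric 2 M} {c : ℝ} {x : M}
    (hcurv : ∀ u v w, curvature D x u v w = c • (h.val x v w • u - h.val x u w • v))
    (v w : TangentSpace (𝓡 2) x) : ricci D x v w = c * h.val x v w := by
  have h1 := h.sum_repr v w
  rw [Fin.sum_univ_two] at h1
  rw [ricci, Fin.sum_univ_two, hcurv, hcurv, h.symm x (frame x 0) w,
    h.symm x (frame x 1) w, h.symm x v w]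
  simp only [map_smul, map_sub, Module.Basis.repr_self, Finsupp.smul_apply, Finsupp.sub_apply,
    Finsupp.single_eq_same, smul_eq_mul]
  linear_combination -c * h1

theorem faraday_of_curvature_eq {D : Connection 2 M} {h : Metric 2 M} {c : ℝ} {x : M}
    (hcurv : ∀ u v w, curvature D x u v w = c • (h.val x v w • u - h.val x u w • v))
    (u v : TangentSpace (𝓡 2) x) : faraday D x u v = 0 := by
  have h1 := h.sum_repr v u
  have h2 := h.sum_repr u v
  rw [h.symm x v u] at h2
  rw [Fin.sum_univ_two] at h1 h2
  rw [faraday, Fin.sum_univ_two, hcurv, hcurv]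
  simp only [map_smul, map_sub, Finsupp.smul_apply, Finsupp.sub_apply, smul_eq_mul]
  linear_combination c / 2 * (h2 - h1)

/-- For the derivative of `φ h` along a connection with `∇h` trace-free, with `s = dφ`: the two
traces differ by the factor two, the dimension, which is the factor in the alignment condition. -/
theorem metricTrace_mvfderiv_add {h : Metric 2 M} {x : M} (s : TangentSpace (𝓡 2) x →L[ℝ] ℝ)
    (a : ℝ) (T : TangentSpace (𝓡 2) x → TangentSpace (𝓡 2) x → ℝ) (u : TangentSpace (𝓡 2) x)
    (hT : metricTrace h.form x T = 0) :
    metricTrace h.form x (fun p q ↦ s p * h.val x q u + a * T p q) = s u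
      ∧ metricTrace h.form x (fun p q ↦ s u * h.val x p q + a * T p q) = 2 * s u := by
  have h1 := metricTrace_smul h.form x a T
  have h2 := metricTrace_smul h.form x (s u) (h.val x · ·)
  simp only [smul_eq_mul, hT, mul_zero, h.metricTrace_self] at h1 h2
  rw [metricTrace_add, metricTrace_add, h1, h2, h.metricTrace_mul]
  push_cast
  exact ⟨add_zero _, by ring⟩

/-! ### Alignment, exactness and the Einstein equations -/

section

variable {D : Connection 2 M} {hD : IsTorsionFree D} {h : Metric 2 M}
  {hDh : ∀ x u v w, covDeriv₂ D h.form x u v w = covDeriv₂ D h.form x v u w}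

theorem isAligned_ahStructure
    (htr : ∀ x u, metricTrace h.form x (covDeriv₂ D h.form x u) = 0)
    (htr' : ∀ x u, metricTrace h.form x (fun a b ↦ covDeriv₂ D h.form x a b u) = 0) :
    (ahStructure D hD h hDh).IsAligned D := by
  refine ⟨mem_projectiveClass_self hD, ?_⟩
  rintro h' ⟨φ, hφ, hpos, hh'⟩ x u
  have h1 := (metricTrace_mvfderiv_add (mvfderiv (𝓡 2) φ x) (φ x) _ u (htr' x u)).1
  have h2 := (metricTrace_mvfderiv_add (mvfderiv (𝓡 2) φ x) (φ x) _ u (htr x u)).2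
  have h3 : covDeriv₂ D h'.form x u = fun v w ↦
      mvfderiv (𝓡 2) φ x u * h.val x v w + φ x * covDeriv₂ D h.form x u v w :=
    funext fun v ↦ funext fun w ↦ covDeriv₂_conformal hφ hh' u v w
  simp only [metricTrace_conformal (hh' x), h3, covDeriv₂_conformal hφ hh', h1, h2, smul_eq_mul]
  ring

theorem isDistinguished_ahStructure
    (htr : ∀ x u, metricTrace h.form x (covDeriv₂ D h.form x u) = 0)
    (htr' : ∀ x u, metricTrace h.form x (fun a b ↦ covDeriv₂ D h.form x a b u) = 0) :
    (ahStructure D hD h hDh).IsDistinguished h :=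
  ⟨mem_conformalClass_self h, D, isAligned_ahStructure htr htr', fun x u ↦ by
    rw [densityDeriv, htr, mvfderiv_const, mul_zero, add_zero, zero_apply]⟩

theorem scalar_of_curvature_eq {c : ℝ} {x : M} {h' : Metric 2 M} {φ : ℝ}
    (hφ : ∀ u v, h'.val x u v = φ * h.val x u v)
    (hcurv : ∀ u v w, curvature D x u v w = c • (h.val x v w • u - h.val x u w • v)) :
    scalar D h' x = φ⁻¹ * (2 * c) := by
  have h1 : ricci D x = fun v w ↦ c • h.val x v w :=
    funext fun v ↦ funext fun w ↦ ricci_of_curvature_eq hcurv v w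
  rw [scalar, metricTrace_conformal hφ, h1, metricTrace_smul, h.metricTrace_self]
  simp [mul_comm c]

theorem isEinstein_ahStructure {c : ℝ}
    (htr : ∀ x u, metricTrace h.form x (covDeriv₂ D h.form x u) = 0)
    (htr' : ∀ x u, metricTrace h.form x (fun a b ↦ covDeriv₂ D h.form x a b u) = 0)
    (hcurv : ∀ x u v w, curvature D x u v w = c • (h.val x v w • u - h.val x u w • v)) :
    (ahStructure D hD h hDh).IsEinstein := by
  refine ⟨D, isAligned_ahStructure htr htr', ?_⟩
  rintro h' ⟨φ, hφ, hpos, hh'⟩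
  have hs (x : M) : scalar D h' x = (φ x)⁻¹ * (2 * c) :=
    scalar_of_curvature_eq (hh' x) (hcurv x)
  refine ⟨fun x u v ↦ ?_, fun x u ↦ ?_⟩
  · rw [ricci_of_curvature_eq (hcurv x), ricci_of_curvature_eq (hcurv x), hs, hh', h.symm x v u]
    have := (hpos x).ne'
    field_simp
    ring
  · have hF : faraday D = fun _ _ _ ↦ 0 :=
      funext fun x ↦ funext fun u ↦ funext fun v ↦ faraday_of_curvature_eq (hcurv x) u v
    have h1 : metricTrace h'.form x (fun a b ↦ covDeriv₂ D (faraday D) x a u b) = 0 := by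
      rw [← metricTrace_zero h'.form x]
      refine metricTrace_congr _ _ fun a b ↦ ?_
      rw [hF, covDeriv₂, mvfderiv_const, zero_apply, sub_zero, sub_zero]
    have h2 := (metricTrace_mvfderiv_add (mvfderiv (𝓡 2) φ x) (φ x) _ u (htr x u)).2
    have h3 : covDeriv₂ D h'.form x u = fun v w ↦
        mvfderiv (𝓡 2) φ x u * h.val x v w + φ x * covDeriv₂ D h.form x u v w :=
      funext fun v ↦ funext fun w ↦ covDeriv₂_conformal hφ hh' u v w
    have hψ : MDifferentiableAt (𝓡 2) 𝓘(ℝ) (scalar D h') x := by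
      have h4 : ContMDiffAt (𝓡 2) 𝓘(ℝ) ∞ (fun x ↦ (φ x)⁻¹ * (2 * c)) x :=
        (hφ.contMDiffAt.inv₀ (hpos x).ne').mul contMDiffAt_const
      rw [show scalar D h' = fun x ↦ (φ x)⁻¹ * (2 * c) from funext hs]
      exact h4.mdifferentiableAt (by simp)
    -- With the Faraday form zero, the conservation condition says that the density `scalar D h' *
    -- |det h'|^{1/2}` is parallel. As `|det h'|^{1/2} = φ |det h|^{1/2}` and `|det h|` is parallel,
    -- this is the constancy of `φ * scalar D h' = 2 c`.
    have h5 := mvfderiv_fun_smul (hφ.mdifferentiable (by simp) x) hψ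
    have h6 : (fun x ↦ φ x • scalar D h' x) = fun _ ↦ 2 * c := by
      funext y
      rw [hs, smul_eq_mul, mul_inv_cancel_left₀ (hpos y).ne']
    rw [h6, mvfderiv_const] at h5
    have h7 := DFunLike.congr_fun h5 u
    simp only [zero_apply, add_apply, smul_apply, ContinuousLinearMap.smulRight_apply,
      smul_eq_mul] at h7
    rw [densityDeriv, h1, metricTrace_conformal (hh' x), h3, h2, smul_eq_mul]
    have := (hpos x).ne'
    field_simp
    linarith

end

end Surface

end ParaKahlerAH

end

/-! ### The main theorem -/

open ParaKahlerAH in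
theorem mainTheorem11
    {M : Type*} [TopologicalSpace M] [T2Space M] [ChartedSpace (EuclideanSpace ℝ (Fin 2)) M]
    [IsManifold (𝓡 2) ∞ M]
    {N : Type*} [TopologicalSpace N] [T2Space N] [ChartedSpace (EuclideanSpace ℝ (Fin 4)) N]
    [IsManifold (𝓡 4) ∞ N]
    (P : ParaKahlerAH.ParaKahlerStructure 4 N) (c : ℝ) (hc : P.HasConstantCurvature c)
    (f : M → N) (hf : Manifold.IsImmersion (𝓡 2) (𝓡 4) ∞ f)
    (hspace : ParaKahlerAH.IsSpacelike (n := 2) P.g f)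
    (hLag : ParaKahlerAH.IsIsotropic (n := 2) P f)
    (hmean : ∀ x, ParaKahlerAH.meanCurvature 2 P.g P.cov f x = 0) :
    ∃ (h : ParaKahlerAH.Metric 2 M) (D nabla : ParaKahlerAH.Connection 2 M)
      (A : ParaKahlerAH.AHStructure M),
      h.form = ParaKahlerAH.inducedForm P.g f ∧
      ParaKahlerAH.IsLeviCivita h D ∧
      ParaKahlerAH.IsInducedConnection P f D nabla ∧
      A.proj = ParaKahlerAH.projectiveClass nabla ∧
      A.conf = ParaKahlerAH.conformalClass h ∧
      A.IsRiemannian ∧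
      A.IsAligned nabla ∧
      A.IsExact ∧
      A.IsDistinguished h ∧
      A.IsEinstein ∧
      ∀ x, ParaKahlerAH.scalar nabla h x = 2 * c := by
  have hL : IsSpacelikeIsotropic 2 P f := ⟨hf.contMDiff, hspace, hLag⟩
  have hdim : 4 = 2 * 2 := rfl
  have hcov (x : M) (u v w : TangentSpace (𝓡 2) x) :
      covDeriv₂ (hL.conn 1) hL.metric.form x u v w = 2 * secondFundamentalForm₃ P f x u v w := by
    rw [hL.covDeriv₂_conn, mul_one]
  have htr (x : M) (u : TangentSpace (𝓡 2) x) :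
      metricTrace hL.metric.form x (covDeriv₂ (hL.conn 1) hL.metric.form x u) = 0 := by
    have h1 := metricTrace_smul hL.metric.form x 2 (secondFundamentalForm₃ P f x u)
    rw [hL.metric_form, hL.secondFundamentalForm₃_trace' (hmean x), smul_zero] at h1
    rw [← h1]
    exact metricTrace_congr _ _ fun a b ↦ hcov x u a b
  have htr' (x : M) (u : TangentSpace (𝓡 2) x) :
      metricTrace hL.metric.form x
        (fun a b ↦ covDeriv₂ (hL.conn 1) hL.metric.form x a b u) = 0 := by
    have h1 := metricTrace_smul hL.metric.form x 2
      (fun a b ↦ secondFundamentalForm₃ P f x a b u)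
    rw [hL.metric_form, secondFundamentalForm₃_trace (hmean x), smul_zero] at h1
    rw [← h1]
    exact metricTrace_congr _ _ fun a b ↦ hcov x a b u
  have hD := hL.isTorsionFree_conn 1
  have hDh (x : M) (u v w : TangentSpace (𝓡 2) x) :
      covDeriv₂ (hL.conn 1) hL.metric.form x u v w
        = covDeriv₂ (hL.conn 1) hL.metric.form x v u w := by
    rw [hcov, hcov, hL.secondFundamentalForm₃_comm_left]
  have hcurv (x : M) (u v w : TangentSpace (𝓡 2) x) := hL.curvature_conn_eq hdim hc u v w
  have hdist : (ahStructure (hL.conn 1) hD hL.metric hDh).IsDistinguished hL.metric :=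
    isDistinguished_ahStructure htr htr'
  refine ⟨hL.metric, hL.conn 0, hL.conn 1, ahStructure (hL.conn 1) hD hL.metric hDh, rfl,
    hL.isLeviCivita_conn, hL.isInducedConnection_conn hmean, rfl, rfl, ?_,
    isAligned_ahStructure htr htr', ⟨hL.metric, hdist⟩, hdist,
    isEinstein_ahStructure htr htr' hcurv, fun x ↦ ?_⟩
  · rintro h' ⟨φ, -, hpos, hh'⟩ x u hu
    rw [hh']
    exact mul_pos (hpos x) (hspace x u hu)
  · rw [scalar_of_curvature_eq (φ := 1) (fun u v ↦ (one_mul _).symm) (hcurv x), inv_one, one_mul]
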